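/- Composition is written in diagrammatic order, $f;g$ meaning first $f$, then $g$. **Effects.** Let $(\mathcal C,\otimes,I)$ be a copy-discard category: a symmetric monoidal category in which every object $X$ carries a commutative comonoid $\Delta_X:X\to X\otimes X$, $\varepsilon_X:X\to I$, compatibly with $\otimes$ and $I$. It *has bilinear effects* if it is equipped with operations $+:\mathcal C(A,I)\times\mathcal C(B,I)\to\mathcal C(A\otimes B,I)$, natural with respect to discard-preserving morphisms ($f;\varepsilon=\varepsilon$), and an element $0\in\mathcal C(I,I)$, such that $+$ is associative, commutative and has unit $0$ (modulo the structure isomorphisms of $\otimes$), and such that, for every $f:A\to B$ and all $g,g':B\to I$, $f;\Delta_B;(g+g')=\Delta_A;(f;g+f;g')$ and $f;\varepsilon_B;0=\varepsilon_A;0$. Each $\mathcal C(B,I)$ is then a commutative monoid with sum $\Delta_B;(g+g')$ and zero $\varepsilon_B;0$, and precomposition preserves sums and zeros. A *loss* of type $(X,A)\to(Y,B)$ is a function $\mathcal C(I,X)\to\mathcal C(B,I)$; losses are added statewise. **Copy-composition.** $\mathbf{CCopara}_l(\mathcal C)$ has the objects of $\mathcal C$ as 0-cells. A 1-cell $f:A\to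 B$ is an object $M$ (its coparameter) with a morphism $A\to M\otimes B$; write $\bar f:A\to B$ for the morphism obtained by discarding $M$. The identity has coparameter $I$. The composite of $f:A\to M\otimes B$ and $g:B\to N\otimes D$ applies $f$, copies $B$ and applies $g$ to one copy; its coparameter is $(M\otimes B)\otimes N$. A 2-cell $f\Rightarrow f'$, for $f:A\to M\otimes B$ and $f':A\to M'\otimes B$, exists only if $\bar f=\bar f'$, and is a morphism $\varphi:A\otimes M\otimes B\to M'$ such that $f'$ is obtained from $f$ by copying the input and the output and applying $\varphi$. Vertical composition is $(a,m,b)\mapsto\psi(a,\varphi(a,m,b),b)$ (the inputs $a,b$ being copied), with the projections as identities; horizontal composition is $(a,m,b,n,d)\mapsto(\varphi(a,m,b),b,\gamma(b,n,d))$. Associators are those of $\otimes$, and the unit 2-cells $1;f\Rightarrow f$ and $f;1\Rightarrow f$ discard the coparameter created by copying; they need not be invertible. $\mathbf{CCopara}_r(\mathcal C)$ is the same for the reversed tensor product (coparameters on the right). Below, "bicategory" means data of this kind: hom-categories, identity 1-cells, functorial horizontal composition, invertible associators, and unit 2-cells in the two directions shown. Subbicategories are collections of cells closed under all of this structure. Lax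 functors and their composites, and icons, are defined for such data by the usual formulas. **Lenses.** $\mathbf{BayesLens}_2$ has pairs $(X,A)$ of objects as 0-cells. A 1-cell $c:(X,A)\to(Y,B)$ is a 1-cell $X\to Y$ of $\mathbf{CCopara}_l$, which by discarding its coparameter acts on states $\pi:I\to X$ by $\pi\mapsto c_*\pi$, together with a 1-cell $c'_\pi:B\to A$ of $\mathbf{CCopara}_r$ for each $\pi$. The backward part of the composite of $c$ and $d$ at $\pi$ is $d'_{c_*\pi};c'_\pi$. 2-cells are pairs of a 2-cell of the forward parts and a family, indexed by $\pi$, of 2-cells of the backward parts. All structure is inherited from $\mathbf{CCopara}_l$ and $\mathbf{CCopara}_r$. **Games.** $\mathbf{SGame}$ has the same 0-cells. A 1-cell $(X,A)\to(Y,B)$ is a lens $c$ with a loss $L^c$. A 2-cell $(c,L^c)\Rightarrow(d,L^d)$ is a 2-cell $\alpha:c\Rightarrow d$ of lenses with a loss $K$ such that $L^c=L^d+K$. Identities have loss $0$; losses of 2-cells add under vertical composition. The composite of $(c,L)$ and $(d,L')$ has the loss $\pi\mapsto L'(c_*\pi)+\overline{d'_{c_*\pi}};L(\pi)$, and the same formula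 gives the loss of a horizontal composite of 2-cells with domains $c$ and $d$. Associators and unit 2-cells have loss $0$. Let $\pi_{\mathsf{Loss}}:\mathbf{SGame}\to\mathbf{BayesLens}_2$ forget the losses. **Loss models.** Let $\mathcal B$ be a subbicategory of $\mathbf{BayesLens}_2$ and let $\pi_{\mathsf{Loss}}|_{\mathcal B}:\mathbf{SGame}|_{\mathcal B}\to\mathcal B$ be the restriction of $\pi_{\mathsf{Loss}}$ to the cells lying over $\mathcal B$. A *loss model* for $\mathcal B$ is a lax section of it: a lax functor $\mathcal B\to\mathbf{SGame}|_{\mathcal B}$ whose composite with $\pi_{\mathsf{Loss}}|_{\mathcal B}$ is the identity. Equivalently, it is a family of losses, one for each 1-cell, 2-cell, unit constraint and composition constraint, subject to the equations of a lax functor. An *icon* $\eta:L\Rightarrow M$ between loss models is a family of 2-cells $\eta_c:L(c)\Rightarrow M(c)$ of $\mathbf{SGame}|_{\mathcal B}$, one for each 1-cell $c$ of $\mathcal B$, natural in the 2-cells of $\mathcal B$ and compatible with the unit and composition constraints. So $\eta_c$ consists of a 2-cell $\underline\eta_c:c\Rightarrow c$ of $\mathcal B$ and a loss. **Proposition.**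 Let $\mathcal C$ be a copy-discard category with bilinear effects and $\mathcal B$ a subbicategory of $\mathbf{BayesLens}_2$. The loss models for $\mathcal B$ are the objects of a symmetric monoidal category $(\mathsf{Loss}(\mathcal B),+,0)$ such that: 1. its morphisms are the icons, with identities and composition given componentwise by those of 2-cells of $\mathbf{SGame}|_{\mathcal B}$; 2. the tensor product of loss models is their sum: the losses that $L+M$ assigns to 1-cells, to 2-cells and to the unit and composition constraints are the sums of those assigned by $L$ and $M$; the tensor product of icons $\eta$, $\theta$ has as its component at $c$ the 2-cell $\underline\eta_c;\underline\theta_c$, with loss the sum of the losses of $\eta_c$ and $\theta_c$; 3. the unit object is the loss model $0$, all of whose losses are $0$; 4. the components of the associators, unitors and symmetries have identities as underlying 2-cells and have loss $0$. -/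

import Mathlib

open CategoryTheory MonoidalCategory ComonObj

universe v u

set_option linter.unusedSectionVars false
set_option linter.unusedVariables false

namespace StatGame
section Wires

/-! ### Copying wires in a monoidal category with chosen comonoids

Composition is written in diagrammatic order: `f ≫ g` is first `f`, then `g`. -/

variable {C : Type u} [Category.{v} C] [MonoidalCategory C] [∀ X : C, ComonObj X]

/-- Copy the leftmost wire `A`. -/
def copyL (A W : C) : A ⊗ W ⟶ A ⊗ (A ⊗ W) := Δ[A] ▷ W ≫ (α_ A A W).hom

/-- Copy the rightmost wire `B`. -/
def copyR (W B : C) : W ⊗ B ⟶ (W ⊗ B) ⊗ B := W ◁ Δ[B] ≫ (α_ W B B).inv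

/-- Apply `φ : A ⊗ M ⊗ B ⟶ M'` while keeping a copy of `B`. -/
def push {A M B M' : C} (φ : A ⊗ (M ⊗ B) ⟶ M') : A ⊗ (M ⊗ B) ⟶ M' ⊗ B :=
  A ◁ copyR M B ≫ (α_ A (M ⊗ B) B).inv ≫ φ ▷ B

/-- Apply `φ : A ⊗ M ⊗ B ⟶ M'` while keeping a copy of `A` and a copy of `B`. -/
def ext {A M B M' : C} (φ : A ⊗ (M ⊗ B) ⟶ M') : A ⊗ (M ⊗ B) ⟶ A ⊗ (M' ⊗ B) :=
  copyL A (M ⊗ B) ≫ A ◁ push φ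

/-- The projection onto `M`, discarding `A` and `B`. -/
def proj (A M B : C) : A ⊗ (M ⊗ B) ⟶ M :=
  (ε[A] ⊗ₘ (M ◁ ε[B])) ≫ (λ_ _).hom ≫ (ρ_ M).hom

lemma copyL_counit (A W : C) : copyL A W ≫ (ε[A] ▷ (A ⊗ W)) ≫ (λ_ _).hom = 𝟙 _ := by
  simp only [copyL, Category.assoc]
  rw [← associator_naturality_left_assoc, ← comp_whiskerRight_assoc, counit_comul]
  monoidal
lemma copyL_counit' (A W : C) : copyL A W ≫ A ◁ (ε[A] ▷ W) ≫ A ◁ (λ_ _).hom = 𝟙 _ := by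
  simp only [copyL, Category.assoc]
  rw [← associator_naturality_middle_assoc, ← comp_whiskerRight_assoc, comul_counit]
  monoidal
lemma copyL_nat (A : C) {W W' : C} (u : W ⟶ W') : A ◁ u ≫ copyL A W' = copyL A W ≫ A ◁ (A ◁ u) := by
  simp only [copyL, Category.assoc]
  rw [whisker_exchange_assoc]
  monoidal
lemma copyL_coassoc (A W : C) : copyL A W ≫ A ◁ copyL A W = copyL A W ≫ copyL A (A ⊗ W) := by
  simp only [copyL, Category.assoc, whiskerLeft_comp]
  rw [← associator_naturality_middle_assoc, ← comp_whiskerRight_assoc, comul_assoc, ← associator_naturality_left_assoc]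
  monoidal

lemma copyR_counit (W B : C) : copyR W B ≫ ((W ⊗ B) ◁ ε[B]) ≫ (ρ_ _).hom = 𝟙 _ := by
  simp only [copyR, Category.assoc]
  rw [← associator_inv_naturality_right_assoc, ← whiskerLeft_comp_assoc, comul_counit]
  monoidal
lemma copyR_counit' (W B : C) : copyR W B ≫ (W ◁ ε[B]) ▷ B ≫ (ρ_ _).hom ▷ B = 𝟙 _ := by
  simp only [copyR, Category.assoc]
  rw [← associator_inv_naturality_middle_assoc, ← whiskerLeft_comp_assoc, counit_comul]
  monoidal
lemma copyR_nat {W W' : C} (u : W ⟶ W') (B : C) : u ▷ B ≫ copyR W' B = copyR W B ≫ (u ▷ B) ▷ B := by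
  simp only [copyR, Category.assoc]
  rw [← whisker_exchange_assoc]
  monoidal
lemma copyR_coassoc (W B : C) : copyR W B ≫ copyR W B ▷ B = copyR W B ≫ copyR (W ⊗ B) B := by
  simp only [copyR, Category.assoc, comp_whiskerRight]
  rw [← associator_inv_naturality_middle_assoc, ← whiskerLeft_comp_assoc, ← associator_inv_naturality_right_assoc,
    ← whiskerLeft_comp_assoc, comul_assoc]
  monoidal

/-- Copy `B`, with `A` and `M` carried along. -/
def carryR (A M B : C) : A ⊗ (M ⊗ B) ⟶ (A ⊗ (M ⊗ B)) ⊗ B := A ◁ copyR M B ≫ (α_ A (M ⊗ B) B).inv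

lemma push_eq {A M B M' : C} (φ : A ⊗ (M ⊗ B) ⟶ M') : push φ = carryR A M B ≫ φ ▷ B := by
  simp [push, carryR]

lemma push_copyR {A M B M' : C} (φ : A ⊗ (M ⊗ B) ⟶ M') :
    push φ ≫ copyR M' B = carryR A M B ≫ push φ ▷ B := by
  have h : carryR A M B ≫ copyR _ B = carryR A M B ≫ carryR A M B ▷ B := by
    have := congrArg (fun t => A ◁ t) (copyR_coassoc M B)
    simp only [whiskerLeft_comp] at this
    have h2 : copyR (A ⊗ (M ⊗ B)) B = (α_ A (M ⊗ B) B).hom ≫ A ◁ copyR (M ⊗ B) B ≫ (α_ _ _ _).inv ≫ (α_ _ _ _).inv ▷ B := by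
      simp only [copyR]; monoidal
    simp only [carryR, Category.assoc, h2, Iso.inv_hom_id_assoc, comp_whiskerRight]
    rw [← reassoc_of% this]
    monoidal
  rw [push_eq, Category.assoc, copyR_nat, reassoc_of% h, comp_whiskerRight]

lemma push_proj (A M B : C) : push (proj A M B) = ε[A] ▷ (M ⊗ B) ≫ (λ_ _).hom := by
  have h := copyR_counit' M B
  have h' := congrArg (fun t => A ◁ t) h
  simp only [whiskerLeft_comp, whiskerLeft_id] at h'
  calc _ = (A ◁ copyR M B ≫ A ◁ (M ◁ ε[B]) ▷ B ≫ A ◁ (ρ_ _).hom ▷ B) ≫ ε[A] ▷ (M ⊗ B) ≫ (λ_ _).hom := by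
        simp only [push, proj, MonoidalCategory.tensorHom_def', Category.assoc]
        monoidal
    _ = _ := by rw [h', Category.id_comp]

lemma ext_proj (A M B : C) : ext (proj A M B) = 𝟙 _ := by
  rw [ext, push_proj, whiskerLeft_comp, copyL_counit']

lemma ext_proj_comp {A M B M' : C} (φ : A ⊗ (M ⊗ B) ⟶ M') : ext φ ≫ proj A M' B = φ := by
  have h1 : push φ ≫ (M' ◁ ε[B]) ≫ (ρ_ _).hom = φ := by
    rw [push_eq, Category.assoc, ← whisker_exchange_assoc]
    have h := congrArg (fun t => A ◁ t) (copyR_counit M B)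
    simp only [whiskerLeft_comp, whiskerLeft_id] at h
    calc _ = (A ◁ copyR M B ≫ A ◁ (M ⊗ B) ◁ ε[B] ≫ A ◁ (ρ_ (M ⊗ B)).hom) ≫ φ := by
          simp only [carryR]; monoidal
      _ = _ := by rw [h, Category.id_comp]
  calc _ = copyL A (M ⊗ B) ≫ (ε[A] ▷ (A ⊗ (M ⊗ B))) ≫ (λ_ _).hom ≫ push φ ≫ (M' ◁ ε[B]) ≫ (ρ_ _).hom := by
        simp only [ext, proj, MonoidalCategory.tensorHom_def, Category.assoc]
        rw [whisker_exchange_assoc]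
        monoidal
    _ = _ := by rw [h1, ← Category.assoc (ε[A] ▷ _), ← Category.assoc, copyL_counit, Category.id_comp]

lemma push_ext {A M B M' M'' : C} (φ : A ⊗ (M ⊗ B) ⟶ M') (φ' : A ⊗ (M' ⊗ B) ⟶ M'') :
    push (ext φ ≫ φ') = ext φ ≫ push φ' := by
  have h1 : ext φ ≫ carryR A M' B = carryR A M B ≫ ext φ ▷ B := by
    have h := congrArg (fun t => A ◁ t) (push_copyR φ)
    simp only [whiskerLeft_comp] at h
    simp only [ext, Category.assoc]
    calc _ = copyL A (M ⊗ B) ≫ (A ◁ push φ ≫ A ◁ copyR M' B) ≫ (α_ _ _ _).inv := by simp [carryR]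
      _ = copyL A (M ⊗ B) ≫ A ◁ A ◁ copyR M B ≫ A ◁ (α_ _ _ _).inv ≫ A ◁ (push φ ▷ B) ≫ (α_ _ _ _).inv := by
          rw [h]; simp only [carryR]; monoidal
      _ = _ := by
          rw [← reassoc_of% (copyL_nat A (copyR M B))]
          simp only [carryR, copyL]; monoidal
  rw [push_eq, push_eq, comp_whiskerRight, reassoc_of% h1]

lemma ext_ext {A M B M' M'' : C} (φ : A ⊗ (M ⊗ B) ⟶ M') (φ' : A ⊗ (M' ⊗ B) ⟶ M'') :
    ext (ext φ ≫ φ') = ext φ ≫ ext φ' := by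
  have h := push_ext φ φ'
  rw [ext, h]
  simp only [ext, whiskerLeft_comp, Category.assoc]
  rw [reassoc_of% (copyL_nat A (push φ)), reassoc_of% (copyL_coassoc A (M ⊗ B))]

lemma push_comp {A M B M' M'' : C} (φ : A ⊗ (M ⊗ B) ⟶ M') (u : M' ⟶ M'') :
    push (φ ≫ u) = push φ ≫ u ▷ B := by simp [push]

/-- The morphism underlying the horizontal composite of 2-cells, informally
`(a, m, b, n, d) ↦ (φ(a, m, b), b, γ(b, n, d))`: the wire `B` is copied twice. -/
def hcompHom {A M B M' N D N' : C} (φ : A ⊗ (M ⊗ B) ⟶ M') (γ : B ⊗ (N ⊗ D) ⟶ N') :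
    A ⊗ (((M ⊗ B) ⊗ N) ⊗ D) ⟶ (M' ⊗ B) ⊗ N' :=
  A ◁ (α_ (M ⊗ B) N D).hom ≫ (α_ A (M ⊗ B) (N ⊗ D)).inv ≫ push φ ▷ (N ⊗ D) ≫
    copyR M' B ▷ (N ⊗ D) ≫ (α_ (M' ⊗ B) B (N ⊗ D)).hom ≫ (M' ⊗ B) ◁ γ

lemma push_hcompHom {A M B M' N D N' : C} (φ : A ⊗ (M ⊗ B) ⟶ M') (γ : B ⊗ (N ⊗ D) ⟶ N') :
    push (hcompHom φ γ) = A ◁ (α_ (M ⊗ B) N D).hom ≫ (α_ A (M ⊗ B) (N ⊗ D)).inv ≫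
      (push φ ≫ copyR M' B) ▷ (N ⊗ D) ≫ (α_ (M' ⊗ B) B (N ⊗ D)).hom ≫ (M' ⊗ B) ◁ push γ ≫
      (α_ _ _ _).inv := by
  have key : ∀ {Z Z' : C} (w : A ⊗ (M ⊗ B) ⟶ Z ⊗ B),
      carryR A ((M ⊗ B) ⊗ N) D ≫ (A ◁ (α_ (M ⊗ B) N D).hom ≫ (α_ A (M ⊗ B) (N ⊗ D)).inv ≫
      w ▷ (N ⊗ D) ≫ (α_ Z B (N ⊗ D)).hom) ▷ D
      = A ◁ (α_ (M ⊗ B) N D).hom ≫ (α_ A (M ⊗ B) (N ⊗ D)).inv ≫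
      w ▷ (N ⊗ D) ≫ (α_ Z B (N ⊗ D)).hom ≫ Z ◁ carryR B N D ≫ (α_ _ _ _).inv := by
    intro Z _ w
    have h : (α_ A (M ⊗ B) (N ⊗ D)).inv ≫ w ▷ (N ⊗ D) ≫ (Z ⊗ B) ◁ copyR N D =
      A ◁ ((M ⊗ B) ◁ copyR N D) ≫ (α_ _ _ _).inv ≫ w ▷ _ := by
      rw [← whisker_exchange]; monoidal
    calc _ = A ◁ (α_ (M ⊗ B) N D).hom ≫ (A ◁ ((M ⊗ B) ◁ copyR N D) ≫ (α_ _ _ _).inv ≫ w ▷ _) ≫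
          (α_ Z B _).hom ≫ Z ◁ (α_ B (N ⊗ D) D).inv ≫ (α_ _ _ _).inv := by
            simp only [carryR, copyR]; monoidal
      _ = _ := by rw [← h]; simp only [carryR, copyR]; monoidal
  have key' := @key (M' ⊗ B) (M' ⊗ B) (push φ ≫ copyR M' B)
  rw [push_eq, push_eq γ]
  calc _ = (carryR A ((M ⊗ B) ⊗ N) D ≫ (A ◁ (α_ (M ⊗ B) N D).hom ≫ (α_ A (M ⊗ B) (N ⊗ D)).inv ≫
      (push φ ≫ copyR M' B) ▷ (N ⊗ D) ≫ (α_ _ B (N ⊗ D)).hom) ▷ D) ≫ ((M' ⊗ B) ◁ γ) ▷ D := by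
        simp [hcompHom]
    _ = _ := by rw [key']; simp

end Wires

/-- The discarding morphisms are compatible with the tensor product. -/
class MonoidalDiscard (C : Type u) [Category.{v} C] [MonoidalCategory C] [∀ X : C, ComonObj X] :
    Prop where
  discard_tensor (X Y : C) : ε[X ⊗ Y] = (ε[X] ⊗ₘ ε[Y]) ≫ (λ_ (𝟙_ C)).hom
  discard_unit : ε[𝟙_ C] = 𝟙 (𝟙_ C)

/-- The 0-cells of the bicategory of coparameterized morphisms with copy-composition (left-handed:
the coparameter is on the left of the codomain): the objects of `C`. -/
structure CCopara (C : Type u) where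
  of ::
  as : C

namespace CCopara
variable {C : Type u} [Category.{v} C] [MonoidalCategory C] [∀ X : C, ComonObj X]

/-- A 1-cell `A ⟶ B` with coparameter `M` is a morphism `A ⟶ M ⊗ B`. -/
structure Hom (X Y : CCopara C) where
  coparam : C
  hom : X.as ⟶ coparam ⊗ Y.as

namespace Hom
variable {X Y : CCopara C}

/-- `f` with a copy of its input kept. -/
def graph (f : Hom X Y) : X.as ⟶ X.as ⊗ (f.coparam ⊗ Y.as) := Δ[X.as] ≫ X.as ◁ f.hom

/-- Discard the coparameter. -/
def discard (f : Hom X Y) : X.as ⟶ Y.as := f.hom ≫ ε[f.coparam] ▷ Y.as ≫ (λ_ Y.as).hom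
end Hom

/-- A 2-cell `f ⟶ g` is a morphism `A ⊗ M ⊗ B ⟶ M'` such that copying the input and the output of
`f` and replacing the coparameter of `f` by the output of this morphism gives `g` (change of
coparameter), and such that `f` and `g` agree after discarding their coparameters. The second
condition follows from the first one when the morphism preserves discarding, thus always in a
Markov category; it says that discarding coparameters is well defined on 2-cells. -/
@[ext]
structure Hom₂ {X Y : CCopara C} (f g : Hom X Y) where
  hom : X.as ⊗ (f.coparam ⊗ Y.as) ⟶ g.coparam
  change : f.graph ≫ push hom = g.hom
  discard : f.discard = g.discard

/-- The identity has coparameter `I`; the composite is copy-composition, with coparameter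
`(M ⊗ B) ⊗ N`, informally `f : a ↦ (m, b)` and `g : b ↦ (n, d)` give `a ↦ (m, b, n, d)`. -/
instance : CategoryStruct (CCopara C) where
  Hom := Hom
  id X := ⟨𝟙_ C, (λ_ X.as).inv⟩
  comp {X Y Z} f g := ⟨(f.coparam ⊗ Y.as) ⊗ g.coparam,
    f.hom ≫ copyR f.coparam Y.as ≫ (f.coparam ⊗ Y.as) ◁ g.hom ≫ (α_ _ _ _).inv⟩

lemma graph_push {X Y : CCopara C} (f : X ⟶ Y) {M' : C}
    (φ : X.as ⊗ (f.coparam ⊗ Y.as) ⟶ M') :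
    Δ[X.as] ≫ X.as ◁ (f.graph ≫ push φ) = f.graph ≫ ext φ := by
  simp only [Hom.graph, ext, copyL, whiskerLeft_comp, Category.assoc]
  rw [whisker_exchange_assoc, comul_assoc_assoc]
  monoidal

/-- Vertical composition is `(a, m, b) ↦ ψ(a, φ(a, m, b), b)`; identities are projections. -/
instance (X Y : CCopara C) : Category (X ⟶ Y) where
  Hom f g := Hom₂ f g
  id f := ⟨proj _ _ _, by
    rw [push_proj, Hom.graph, Category.assoc, whisker_exchange_assoc, ← Category.assoc, counit_comul]
    simp, rfl⟩
  comp {f g h} φ ψ := ⟨ext φ.hom ≫ ψ.hom, by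
    rw [push_ext, ← Category.assoc, ← graph_push, φ.change, ← ψ.change]; rfl, φ.discard.trans ψ.discard⟩
  id_comp φ := Hom₂.ext (by simp [ext_proj])
  comp_id φ := Hom₂.ext (by simp [ext_proj_comp])
  assoc φ ψ χ := Hom₂.ext (by simp [ext_ext])

@[simp] lemma id_coparam (X : CCopara C) : (𝟙 X : X ⟶ X).coparam = 𝟙_ C := rfl
@[simp] lemma id_hom (X : CCopara C) : (𝟙 X : X ⟶ X).hom = (λ_ X.as).inv := rfl
@[simp] lemma comp_coparam {X Y Z : CCopara C} (f : X ⟶ Y) (g : Y ⟶ Z) :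
  (f ≫ g).coparam = (f.coparam ⊗ Y.as) ⊗ g.coparam := rfl
lemma comp_hom {X Y Z : CCopara C} (f : X ⟶ Y) (g : Y ⟶ Z) :
  (f ≫ g).hom = f.hom ≫ copyR f.coparam Y.as ≫ (f.coparam ⊗ Y.as) ◁ g.hom ≫ (α_ _ _ _).inv := rfl

@[ext] lemma hom₂_ext {X Y : CCopara C} {f g : X ⟶ Y} {φ ψ : f ⟶ g} (h : φ.hom = ψ.hom) : φ = ψ :=
  Hom₂.ext h
lemma id_hom₂ {X Y : CCopara C} (f : X ⟶ Y) : Hom₂.hom (𝟙 f) = proj _ _ _ := rfl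
lemma comp_hom₂ {X Y : CCopara C} {f g h : X ⟶ Y} (φ : f ⟶ g) (ψ : g ⟶ h) :
  Hom₂.hom (φ ≫ ψ) = ext φ.hom ≫ ψ.hom := rfl

lemma hcomp_change {X Y Z : CCopara C} {f f' : X ⟶ Y} {g g' : Y ⟶ Z} (φ : f ⟶ f') (γ : g ⟶ g') :
    Hom.graph (f ≫ g) ≫ push (hcompHom φ.hom γ.hom) = (f' ≫ g').hom := by
  have h1 : Hom.graph (f ≫ g) ≫ X.as ◁ (α_ (f.coparam ⊗ Y.as) g.coparam Z.as).hom ≫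
      (α_ X.as (f.coparam ⊗ Y.as) (g.coparam ⊗ Z.as)).inv =
      Hom.graph f ≫ carryR X.as f.coparam Y.as ≫ (_ ◁ g.hom) := by
    simp only [Hom.graph, comp_hom, carryR]
    monoidal
  have h2 : copyR f'.coparam Y.as ≫ copyR f'.coparam Y.as ▷ Y.as ≫ (α_ _ _ _).hom =
      copyR f'.coparam Y.as ≫ (f'.coparam ⊗ Y.as) ◁ Δ[Y.as] := by
    rw [reassoc_of% (copyR_coassoc f'.coparam Y.as)]
    simp [copyR]
  rw [push_hcompHom, reassoc_of% h1, whisker_exchange_assoc, comp_whiskerRight, Category.assoc,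
    ← reassoc_of% (push_copyR φ.hom), ← Category.assoc, φ.change, comp_hom, ← γ.change]
  calc _ = f'.hom ≫ (copyR f'.coparam Y.as ≫ copyR f'.coparam Y.as ▷ Y.as ≫ (α_ _ _ _).hom) ≫
        (f'.coparam ⊗ Y.as) ◁ (Y.as ◁ g.hom ≫ push γ.hom) ≫ (α_ _ _ _).inv := by
        monoidal
    _ = _ := by rw [h2]; simp [Hom.graph]

lemma graph_push_proj {X Y : CCopara C} (f : X ⟶ Y) {M' : C} (u : f.coparam ⟶ M') :
    f.graph ≫ push (proj X.as f.coparam Y.as ≫ u) = f.hom ≫ u ▷ Y.as := by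
  have h := (𝟙 f : f ⟶ f).change
  rw [push_comp, ← Category.assoc]
  exact congrArg (· ≫ u ▷ Y.as) h

lemma discard_iso {X Y : C} (u : X ≅ Y) (h : u.hom ≫ ε[Y] = ε[X]) : u.inv ≫ ε[X] = ε[Y] := by
  rw [← h]; simp

lemma hcompHom_proj (A M B N D : C) : hcompHom (proj A M B) (proj B N D) = proj A ((M ⊗ B) ⊗ N) D := by
  have h := copyR_counit' M B
  have h1 : push (proj A M B) ▷ (N ⊗ D) ≫ copyR M B ▷ (N ⊗ D) =
    (ε[A] ▷ (M ⊗ B) ≫ (λ_ _).hom ≫ copyR M B) ▷ (N ⊗ D) := by rw [push_proj]; simp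
  have h2 := copyR_counit M B
  calc _ = A ◁ (α_ (M ⊗ B) N D).hom ≫ (α_ A (M ⊗ B) (N ⊗ D)).inv ≫
      (ε[A] ▷ (M ⊗ B) ≫ (λ_ _).hom) ▷ (N ⊗ D) ≫ (copyR M B ≫ (M ⊗ B) ◁ ε[B] ≫ (ρ_ _).hom) ▷ (N ⊗ D) ≫
      (M ⊗ B) ◁ (N ◁ ε[D] ≫ (ρ_ N).hom)  := by
        simp only [hcompHom]
        rw [reassoc_of% h1]
        simp only [proj, MonoidalCategory.tensorHom_def]
        monoidal
    _ = _ := by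
        rw [h2]
        simp only [proj, MonoidalCategory.tensorHom_def]
        monoidal

lemma hcompHom_ext {A M M' M'' B N N' N'' D : C} (φ : A ⊗ (M ⊗ B) ⟶ M') (φ' : A ⊗ (M' ⊗ B) ⟶ M'')
    (γ : B ⊗ (N ⊗ D) ⟶ N') (γ' : B ⊗ (N' ⊗ D) ⟶ N'') :
    hcompHom (ext φ ≫ φ') (ext γ ≫ γ') = ext (hcompHom φ γ) ≫ hcompHom φ' γ' := by
  have e1 : ∀ {Z : C} (w : A ⊗ (M' ⊗ B) ⟶ Z),
      ext (hcompHom φ γ) ≫ A ◁ (α_ (M' ⊗ B) N' D).hom ≫ (α_ A (M' ⊗ B) (N' ⊗ D)).inv ≫ w ▷ (N' ⊗ D) =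
      A ◁ (α_ (M ⊗ B) N D).hom ≫ (α_ A (M ⊗ B) (N ⊗ D)).inv ≫
      (copyL A (M ⊗ B) ≫ A ◁ (push φ ≫ copyR M' B)) ▷ (N ⊗ D) ≫ (α_ A _ _).hom ≫
        A ◁ (α_ (M' ⊗ B) B (N ⊗ D)).hom ≫ (α_ _ _ _).inv ≫ w ▷ _ ≫ Z ◁ push γ := by
    intro Z w
    rw [ext, push_hcompHom, ← whisker_exchange w]
    simp only [copyL]
    monoidal
  have e2 : ext φ ≫ carryR A M' B ≫ (push φ' ≫ copyR M'' B) ▷ B =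
      ext φ ≫ push φ' ≫ copyR M'' B ≫ copyR (M'' ⊗ B) B := by
    rw [comp_whiskerRight, ← reassoc_of% (push_copyR φ'), copyR_coassoc]
  have e3 := e1 (push φ' ≫ copyR M'' B)
  symm
  calc _ = (ext (hcompHom φ γ) ≫ A ◁ (α_ (M' ⊗ B) N' D).hom ≫ (α_ A (M' ⊗ B) (N' ⊗ D)).inv ≫
        (push φ' ≫ copyR M'' B) ▷ (N' ⊗ D)) ≫ (α_ _ _ _).hom ≫ (M'' ⊗ B) ◁ γ' := by
        simp [hcompHom]
    _ = A ◁ (α_ (M ⊗ B) N D).hom ≫ (α_ A (M ⊗ B) (N ⊗ D)).inv ≫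
        (ext φ ≫ carryR A M' B ≫ (push φ' ≫ copyR M'' B) ▷ B) ▷ (N ⊗ D) ≫
        (α_ _ _ _).hom ≫ _ ◁ push γ ≫ (α_ _ _ _).hom ≫ (M'' ⊗ B) ◁ γ' := by
        rw [e3]; simp only [ext, carryR]; monoidal
    _ = _ := by
        rw [e2, hcompHom, push_ext]
        simp only [ext, copyL, copyR]
        monoidal

variable [MonoidalDiscard C]

lemma discard_id (X : CCopara C) : Hom.discard (𝟙 X) = 𝟙 X.as := by
  simp [Hom.discard, MonoidalDiscard.discard_unit]

lemma discard_comp {X Y Z : CCopara C} (f : X ⟶ Y) (g : Y ⟶ Z) :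
    Hom.discard (f ≫ g) = f.discard ≫ g.discard := by
  have h := copyR_counit' f.coparam Y.as
  have h2 : (α_ (f.coparam ⊗ Y.as) g.coparam Z.as).inv ≫ ε[(f.coparam ⊗ Y.as) ⊗ g.coparam] ▷ Z.as =
      (f.coparam ◁ ε[Y.as] ≫ ε[f.coparam] ▷ (𝟙_ C)) ▷ (g.coparam ⊗ Z.as) ≫ (λ_ _).hom ▷ _ ≫
        (𝟙_ C) ◁ (ε[g.coparam] ▷ Z.as) ≫ (α_ _ _ _).inv ≫ (λ_ _).hom ▷ _ := by
    simp only [MonoidalDiscard.discard_tensor]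
    rw [MonoidalCategory.tensorHom_def' ε[f.coparam] ε[Y.as]]
    simp only [MonoidalCategory.tensorHom_def]
    monoidal
  simp only [Hom.discard, comp_hom, comp_coparam, Category.assoc, reassoc_of% h2]
  rw [whisker_exchange_assoc]
  calc _ = f.hom ≫ (copyR f.coparam Y.as ≫ (f.coparam ◁ ε[Y.as]) ▷ Y.as ≫ (ρ_ _).hom ▷ Y.as) ≫
      ε[f.coparam] ▷ Y.as ≫ (λ_ Y.as).hom ≫ g.hom ≫ ε[g.coparam] ▷ Z.as ≫ (λ_ Z.as).hom := by
        monoidal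
    _ = _ := by rw [h]; simp

/-- Horizontal composition of 2-cells. -/
def hcomp {X Y Z : CCopara C} {f f' : X ⟶ Y} {g g' : Y ⟶ Z} (φ : f ⟶ f') (γ : g ⟶ g') :
    f ≫ g ⟶ f' ≫ g' :=
  ⟨hcompHom φ.hom γ.hom, hcomp_change φ γ, by rw [discard_comp, discard_comp, φ.discard, γ.discard]⟩

/-- The 2-cell induced by a discard-preserving morphism `u` of coparameters, which ignores the
input and the output. -/
def ofHom {X Y : CCopara C} {f g : X ⟶ Y} (u : f.coparam ⟶ g.coparam)
    (h : f.hom ≫ u ▷ Y.as = g.hom) (hu : u ≫ ε[g.coparam] = ε[f.coparam]) : f ⟶ g :=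
  ⟨proj _ _ _ ≫ u, by rw [graph_push_proj, h], by
    simp only [Hom.discard]
    rw [← h, ← hu]; simp⟩

lemma ofHom_comp_eq_id {X Y : CCopara C} {f g : X ⟶ Y} (u : f.coparam ⟶ g.coparam)
    (h : f.hom ≫ u ▷ Y.as = g.hom) (hu : u ≫ ε[g.coparam] = ε[f.coparam])
    (w : g.coparam ⟶ f.coparam)
    (h' : g.hom ≫ w ▷ Y.as = f.hom) (hw : w ≫ ε[f.coparam] = ε[g.coparam]) (e : u ≫ w = 𝟙 _) :
    ofHom u h hu ≫ ofHom w h' hw = 𝟙 f := by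
  ext
  rw [comp_hom₂, id_hom₂, ofHom, ofHom, ← Category.assoc, ext_proj_comp, Category.assoc, e,
    Category.comp_id]

/-- The reassociation of the coparameters of triple composites. -/
def assocHom (P N D Q : C) : ((P ⊗ N) ⊗ D) ⊗ Q ≅ P ⊗ ((N ⊗ D) ⊗ Q) :=
  whiskerRightIso (α_ P N D) Q ≪≫ α_ P (N ⊗ D) Q

lemma assocHom_discard (P N D Q : C) : (assocHom P N D Q).hom ≫ ε = ε := by
  simp only [assocHom, MonoidalDiscard.discard_tensor, MonoidalCategory.tensorHom_def, Iso.trans_hom, whiskerRightIso_hom]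
  monoidal

lemma assoc_change {W X Y Z : CCopara C} (f : W ⟶ X) (g : X ⟶ Y) (h : Y ⟶ Z) :
    ((f ≫ g) ≫ h).hom ≫ (assocHom (f.coparam ⊗ X.as) g.coparam Y.as h.coparam).hom ▷ Z.as =
    (f ≫ (g ≫ h)).hom := by
  simp only [comp_hom, comp_coparam, assocHom, copyR, Iso.trans_hom, whiskerRightIso_hom]
  monoidal

/-- The associator of copy-composition. -/
def associator {W X Y Z : CCopara C} (f : W ⟶ X) (g : X ⟶ Y) (h : Y ⟶ Z) :
    (f ≫ g) ≫ h ≅ f ≫ (g ≫ h) where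
  hom := ofHom (assocHom _ _ _ _).hom (assoc_change f g h) (assocHom_discard _ _ _ _)
  inv := ofHom (assocHom _ _ _ _).inv
    (by rw [← assoc_change, Category.assoc, hom_inv_whiskerRight]; exact Category.comp_id _)
    (discard_iso _ (assocHom_discard _ _ _ _))
  hom_inv_id := ofHom_comp_eq_id _ _ _ _ _ _ (assocHom _ _ _ _).hom_inv_id
  inv_hom_id := ofHom_comp_eq_id _ _ _ _ _ _ (assocHom _ _ _ _).inv_hom_id

/-- The unit 2-cell `𝟙 X ≫ f ⟶ f`, which discards the coparameter created by copy-composition. -/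
def leftUnitor {X Y : CCopara C} (f : X ⟶ Y) : 𝟙 X ≫ f ⟶ f :=
  ofHom (((λ_ X.as).hom ≫ ε[X.as]) ▷ f.coparam ≫ (λ_ _).hom) (by
    have h : (𝟙_ C ⊗ X.as) ◁ f.hom ≫ (α_ _ _ _).inv ≫
      (((λ_ X.as).hom ≫ ε[X.as]) ▷ f.coparam ≫ (λ_ _).hom) ▷ Y.as =
      ((λ_ X.as).hom ≫ ε[X.as]) ▷ X.as ≫ (λ_ _).hom ≫ f.hom := by
      rw [← MonoidalCategory.leftUnitor_naturality f.hom, ← whisker_exchange_assoc]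
      monoidal
    calc _ = (λ_ X.as).inv ≫ copyR (𝟙_ C) X.as ≫ ((𝟙_ C ⊗ X.as) ◁ f.hom ≫ (α_ _ _ _).inv ≫
      (((λ_ X.as).hom ≫ ε[X.as]) ▷ f.coparam ≫ (λ_ _).hom) ▷ Y.as) := by
          simp [comp_hom]
      _ = (λ_ X.as).inv ≫ copyR (𝟙_ C) X.as ≫ (𝟙_ C ◁ ε[X.as]) ▷ X.as ≫ (ρ_ _).hom ▷ X.as ≫
        (λ_ _).hom ≫ f.hom := by rw [h]; monoidal
      _ = _ := by rw [reassoc_of% (copyR_counit' (𝟙_ C) X.as)]; simp)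
    (by simp only [id_coparam, comp_coparam, MonoidalDiscard.discard_tensor, MonoidalDiscard.discard_unit, MonoidalCategory.tensorHom_def]; monoidal)

/-- The unit 2-cell `f ≫ 𝟙 Y ⟶ f`, which discards the coparameter created by copy-composition. -/
def rightUnitor {X Y : CCopara C} (f : X ⟶ Y) : f ≫ 𝟙 Y ⟶ f :=
  ofHom ((ρ_ _).hom ≫ f.coparam ◁ ε[Y.as] ≫ (ρ_ _).hom) (by
    calc _ = f.hom ≫ copyR f.coparam Y.as ≫ (f.coparam ◁ ε[Y.as]) ▷ Y.as ≫ (ρ_ _).hom ▷ Y.as := by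
          simp only [comp_hom, id_hom, id_coparam]; monoidal
      _ = _ := by rw [copyR_counit']; simp)
    (by
      simp only [id_coparam, comp_coparam, MonoidalDiscard.discard_tensor, MonoidalDiscard.discard_unit]
      rw [MonoidalCategory.tensorHom_def' ε[f.coparam] ε[Y.as]]
      simp only [MonoidalCategory.tensorHom_def]; monoidal)

lemma hcomp_id {X Y Z : CCopara C} (f : X ⟶ Y) (g : Y ⟶ Z) : hcomp (𝟙 f) (𝟙 g) = 𝟙 (f ≫ g) := by
  ext; exact hcompHom_proj _ _ _ _ _

lemma hcomp_comp {X Y Z : CCopara C} {f f' f'' : X ⟶ Y} {g g' g'' : Y ⟶ Z}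
    (φ : f ⟶ f') (φ' : f' ⟶ f'') (γ : g ⟶ g') (γ' : g' ⟶ g'') :
    hcomp (φ ≫ φ') (γ ≫ γ') = hcomp φ γ ≫ hcomp φ' γ' := by
  ext; exact hcompHom_ext _ _ _ _

end CCopara

/-! ### The data of a bicategory, lax functors, subbicategories -/

universe w₁ v₁ u₁ w₂ v₂ u₂ w₃ v₃ u₃

/-- The data of a bicategory on which lax functors and icons depend: hom-categories, identity
1-cells, horizontal composition functors, associators, and unit 2-cells. For copy-composition the
unit 2-cells discard a coparameter and are not invertible, so they are recorded as 2-cells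
`𝟙 X ≫ f ⟶ f` and `f ≫ 𝟙 Y ⟶ f`. -/
class BicategoryData (D : Type u₁) extends CategoryStruct.{v₁} D where
  homCategory (X Y : D) : Category.{w₁} (X ⟶ Y)
  hcomp {X Y Z : D} {f f' : X ⟶ Y} {g g' : Y ⟶ Z} (α : f ⟶ f') (β : g ⟶ g') : f ≫ g ⟶ f' ≫ g'
  hcomp_id {X Y Z : D} (f : X ⟶ Y) (g : Y ⟶ Z) : hcomp (𝟙 f) (𝟙 g) = 𝟙 (f ≫ g)
  hcomp_comp {X Y Z : D} {f f' f'' : X ⟶ Y} {g g' g'' : Y ⟶ Z} (α : f ⟶ f') (α' : f' ⟶ f'')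
    (β : g ⟶ g') (β' : g' ⟶ g'') : hcomp (α ≫ α') (β ≫ β') = hcomp α β ≫ hcomp α' β'
  assoc {W X Y Z : D} (f : W ⟶ X) (g : X ⟶ Y) (h : Y ⟶ Z) : (f ≫ g) ≫ h ≅ f ≫ g ≫ h
  unitL {X Y : D} (f : X ⟶ Y) : 𝟙 X ≫ f ⟶ f
  unitR {X Y : D} (f : X ⟶ Y) : f ≫ 𝟙 Y ⟶ f

attribute [instance] BicategoryData.homCategory

open BicategoryData

/-- A lax functor. -/
structure LaxFun (D : Type u₁) [BicategoryData.{w₁, v₁} D] (E : Type u₂)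
    [BicategoryData.{w₂, v₂} E] where
  obj : D → E
  map {X Y : D} (f : X ⟶ Y) : obj X ⟶ obj Y
  map₂ {X Y : D} {f g : X ⟶ Y} (α : f ⟶ g) : map f ⟶ map g
  mapId (X : D) : 𝟙 (obj X) ⟶ map (𝟙 X)
  mapComp {X Y Z : D} (f : X ⟶ Y) (g : Y ⟶ Z) : map f ≫ map g ⟶ map (f ≫ g)
  map₂_id {X Y : D} (f : X ⟶ Y) : map₂ (𝟙 f) = 𝟙 (map f)
  map₂_comp {X Y : D} {f g h : X ⟶ Y} (α : f ⟶ g) (β : g ⟶ h) :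
    map₂ (α ≫ β) = map₂ α ≫ map₂ β
  mapComp_naturality {X Y Z : D} {f f' : X ⟶ Y} {g g' : Y ⟶ Z} (α : f ⟶ f') (β : g ⟶ g') :
    mapComp f g ≫ map₂ (hcomp α β) = hcomp (map₂ α) (map₂ β) ≫ mapComp f' g'
  map₂_assoc {W X Y Z : D} (f : W ⟶ X) (g : X ⟶ Y) (h : Y ⟶ Z) :
    hcomp (mapComp f g) (𝟙 (map h)) ≫ mapComp (f ≫ g) h ≫ map₂ (assoc f g h).hom =
      (assoc (map f) (map g) (map h)).hom ≫ hcomp (𝟙 (map f)) (mapComp g h) ≫ mapComp f (g ≫ h)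
  map₂_unitL {X Y : D} (f : X ⟶ Y) :
    hcomp (mapId X) (𝟙 (map f)) ≫ mapComp (𝟙 X) f ≫ map₂ (unitL f) = unitL (map f)
  map₂_unitR {X Y : D} (f : X ⟶ Y) :
    hcomp (𝟙 (map f)) (mapId Y) ≫ mapComp f (𝟙 Y) ≫ map₂ (unitR f) = unitR (map f)

namespace LaxFun

lemma mk_eq {D : Type u₁} [BicategoryData.{w₁, v₁} D] {E : Type u₂} [BicategoryData.{w₂, v₂} E]
    (F : LaxFun D E) (mapId : ∀ X : D, 𝟙 (F.obj X) ⟶ F.map (𝟙 X))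
    (mapComp : ∀ {X Y Z : D} (f : X ⟶ Y) (g : Y ⟶ Z), F.map f ≫ F.map g ⟶ F.map (f ≫ g))
    (h : mapId = F.mapId) (h' : @mapComp = @F.mapComp) (a1 a2 a3 a4 a5 a6) :
    LaxFun.mk F.obj F.map F.map₂ mapId mapComp a1 a2 a3 a4 a5 a6 = F := by
  subst h h'; rfl

/-- The identity lax functor. -/
def id (D : Type u₁) [BicategoryData.{w₁, v₁} D] : LaxFun D D where
  obj X := X
  map f := f
  map₂ α := α
  mapId _ := 𝟙 _
  mapComp _ _ := 𝟙 _
  map₂_id _ := rfl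
  map₂_comp _ _ := rfl
  mapComp_naturality _ _ := by simp
  map₂_assoc _ _ _ := by simp [hcomp_id]
  map₂_unitL _ := by simp [hcomp_id]
  map₂_unitR _ := by simp [hcomp_id]

/-- The composite of lax functors. -/
def comp {D : Type u₁} [BicategoryData.{w₁, v₁} D] {E : Type u₂} [BicategoryData.{w₂, v₂} E]
    {E' : Type u₃} [BicategoryData.{w₃, v₃} E'] (F : LaxFun D E) (G : LaxFun E E') :
    LaxFun D E' where
  obj X := G.obj (F.obj X)
  map f := G.map (F.map f)
  map₂ α := G.map₂ (F.map₂ α)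
  mapId X := G.mapId (F.obj X) ≫ G.map₂ (F.mapId X)
  mapComp f g := G.mapComp (F.map f) (F.map g) ≫ G.map₂ (F.mapComp f g)
  map₂_id f := by rw [F.map₂_id, G.map₂_id]
  map₂_comp α β := by rw [F.map₂_comp, G.map₂_comp]
  mapComp_naturality α β := by
    rw [Category.assoc, ← G.map₂_comp, F.mapComp_naturality, G.map₂_comp, ← Category.assoc,
      G.mapComp_naturality, Category.assoc]
  map₂_assoc f g h := by
    have e1 : hcomp (G.mapComp (F.map f) (F.map g) ≫ G.map₂ (F.mapComp f g)) (𝟙 (G.map (F.map h))) =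
        hcomp (G.mapComp _ _) (𝟙 _) ≫ hcomp (G.map₂ (F.mapComp f g)) (G.map₂ (𝟙 (F.map h))) := by
      rw [← hcomp_comp, G.map₂_id, Category.comp_id]
    have e2 : hcomp (𝟙 (G.map (F.map f))) (G.mapComp (F.map g) (F.map h) ≫ G.map₂ (F.mapComp g h)) =
        hcomp (𝟙 _) (G.mapComp _ _) ≫ hcomp (G.map₂ (𝟙 (F.map f))) (G.map₂ (F.mapComp g h)) := by
      rw [← hcomp_comp, G.map₂_id, Category.comp_id]
    rw [e1, e2]
    simp only [Category.assoc]
    rw [← reassoc_of% (G.mapComp_naturality (F.mapComp f g) (𝟙 (F.map h))), ← G.map₂_comp,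
      ← G.map₂_comp, F.map₂_assoc,
      ← reassoc_of% (G.mapComp_naturality (𝟙 (F.map f)) (F.mapComp g h)), ← G.map₂_comp,
      ← reassoc_of% (G.map₂_assoc (F.map f) (F.map g) (F.map h)), ← G.map₂_comp]
  map₂_unitL f := by
    have e1 : hcomp (G.mapId _ ≫ G.map₂ (F.mapId _)) (𝟙 (G.map (F.map f))) =
        hcomp (G.mapId _) (𝟙 _) ≫ hcomp (G.map₂ (F.mapId _)) (G.map₂ (𝟙 (F.map f))) := by
      rw [← hcomp_comp, G.map₂_id, Category.comp_id]
    rw [e1]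
    simp only [Category.assoc]
    rw [← reassoc_of% (G.mapComp_naturality (F.mapId _) (𝟙 (F.map f))), ← G.map₂_comp,
      ← G.map₂_comp, F.map₂_unitL, G.map₂_unitL]
  map₂_unitR f := by
    have e1 : hcomp (𝟙 (G.map (F.map f))) (G.mapId _ ≫ G.map₂ (F.mapId _)) =
        hcomp (𝟙 _) (G.mapId _) ≫ hcomp (G.map₂ (𝟙 (F.map f))) (G.map₂ (F.mapId _)) := by
      rw [← hcomp_comp, G.map₂_id, Category.comp_id]
    rw [e1]
    simp only [Category.assoc]
    rw [← reassoc_of% (G.mapComp_naturality (𝟙 (F.map f)) (F.mapId _)), ← G.map₂_comp,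
      ← G.map₂_comp, F.map₂_unitR, G.map₂_unitR]

end LaxFun

/-- A subbicategory: a choice of 0-cells, of 1-cells between them and of 2-cells between these,
closed under all operations. -/
structure SubBicategory (D : Type u₁) [BicategoryData.{w₁, v₁} D] where
  obj : D → Prop
  hom {X Y : D} : (X ⟶ Y) → Prop
  cell {X Y : D} {f g : X ⟶ Y} : (f ⟶ g) → Prop
  src_mem {X Y : D} {f : X ⟶ Y} : hom f → obj X
  tgt_mem {X Y : D} {f : X ⟶ Y} : hom f → obj Y
  src_mem₂ {X Y : D} {f g : X ⟶ Y} {α : f ⟶ g} : cell α → hom f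
  tgt_mem₂ {X Y : D} {f g : X ⟶ Y} {α : f ⟶ g} : cell α → hom g
  id_mem {X : D} : obj X → hom (𝟙 X)
  comp_mem {X Y Z : D} {f : X ⟶ Y} {g : Y ⟶ Z} : hom f → hom g → hom (f ≫ g)
  id_mem₂ {X Y : D} {f : X ⟶ Y} : hom f → cell (𝟙 f)
  comp_mem₂ {X Y : D} {f g h : X ⟶ Y} {α : f ⟶ g} {β : g ⟶ h} : cell α → cell β → cell (α ≫ β)
  hcomp_mem {X Y Z : D} {f f' : X ⟶ Y} {g g' : Y ⟶ Z} {α : f ⟶ f'} {β : g ⟶ g'} :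
    cell α → cell β → cell (hcomp α β)
  assoc_mem {W X Y Z : D} {f : W ⟶ X} {g : X ⟶ Y} {h : Y ⟶ Z} :
    hom f → hom g → hom h → cell (assoc f g h).hom
  assoc_inv_mem {W X Y Z : D} {f : W ⟶ X} {g : X ⟶ Y} {h : Y ⟶ Z} :
    hom f → hom g → hom h → cell (assoc f g h).inv
  unitL_mem {X Y : D} {f : X ⟶ Y} : hom f → cell (unitL f)
  unitR_mem {X Y : D} {f : X ⟶ Y} : hom f → cell (unitR f)

namespace SubBicategory

variable {D : Type u₁} [BicategoryData.{w₁, v₁} D]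

/-- The 0-cells of a subbicategory. -/
structure Obj (S : SubBicategory D) : Type u₁ where
  val : D
  mem : S.obj val

/-- The 1-cells of a subbicategory. -/
structure Hom {S : SubBicategory D} (X Y : S.Obj) : Type v₁ where
  val : X.val ⟶ Y.val
  mem : S.hom val

/-- The 2-cells of a subbicategory. -/
@[ext]
structure Cell {S : SubBicategory D} {X Y : S.Obj} (f g : Hom X Y) : Type w₁ where
  val : f.val ⟶ g.val
  mem : S.cell val

instance (S : SubBicategory D) : CategoryStruct.{v₁} S.Obj where
  Hom X Y := Hom X Y
  id X := ⟨𝟙 X.1, S.id_mem X.2⟩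
  comp f g := ⟨f.1 ≫ g.1, S.comp_mem f.2 g.2⟩

instance (S : SubBicategory D) (X Y : S.Obj) : Category.{w₁} (X ⟶ Y) where
  Hom f g := Cell f g
  id f := ⟨𝟙 f.1, S.id_mem₂ f.2⟩
  comp α β := ⟨α.1 ≫ β.1, S.comp_mem₂ α.2 β.2⟩
  id_comp _ := Cell.ext (Category.id_comp _)
  comp_id _ := Cell.ext (Category.comp_id _)
  assoc _ _ _ := Cell.ext (Category.assoc _ _ _)

instance (S : SubBicategory D) : BicategoryData.{w₁, v₁} S.Obj where
  homCategory X Y := inferInstance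
  hcomp α β := ⟨hcomp α.1 β.1, S.hcomp_mem α.2 β.2⟩
  hcomp_id f g := Cell.ext (hcomp_id f.1 g.1)
  hcomp_comp α α' β β' := Cell.ext (hcomp_comp α.1 α'.1 β.1 β'.1)
  assoc f g h :=
    { hom := ⟨(assoc f.1 g.1 h.1).hom, S.assoc_mem f.2 g.2 h.2⟩
      inv := ⟨(assoc f.1 g.1 h.1).inv, S.assoc_inv_mem f.2 g.2 h.2⟩
      hom_inv_id := Cell.ext (assoc f.1 g.1 h.1).hom_inv_id
      inv_hom_id := Cell.ext (assoc f.1 g.1 h.1).inv_hom_id }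
  unitL f := ⟨unitL f.1, S.unitL_mem f.2⟩
  unitR f := ⟨unitR f.1, S.unitR_mem f.2⟩

end SubBicategory

instance (C : Type u) [Category.{v} C] [MonoidalCategory C] [∀ X : C, ComonObj X]
    [MonoidalDiscard C] : BicategoryData (CCopara C) where
  homCategory X Y := inferInstance
  hcomp := CCopara.hcomp
  hcomp_id := CCopara.hcomp_id
  hcomp_comp := CCopara.hcomp_comp
  assoc := CCopara.associator
  unitL := CCopara.leftUnitor
  unitR := CCopara.rightUnitor

/-! ### The right-handed construction -/

section RightHanded

variable {C : Type u} [Category.{v} C] [MonoidalCategory C]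

instance [∀ X : C, ComonObj X] (X : Cᴹᵒᵖ) : ComonObj X where
  counit := ε[X.unmop].mop
  comul := Δ[X.unmop].mop
  counit_comul := Quiver.Hom.unmop_inj (ComonObj.comul_counit X.unmop)
  comul_counit := Quiver.Hom.unmop_inj (ComonObj.counit_comul X.unmop)
  comul_assoc := Quiver.Hom.unmop_inj (by
    change Δ[X.unmop] ≫ Δ[X.unmop] ▷ X.unmop =
      Δ[X.unmop] ≫ X.unmop ◁ Δ[X.unmop] ≫ (α_ X.unmop X.unmop X.unmop).inv
    simp)

instance [∀ X : C, ComonObj X] [MonoidalDiscard C] : MonoidalDiscard Cᴹᵒᵖ where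
  discard_tensor X Y := Quiver.Hom.unmop_inj (by
    change ε[Y.unmop ⊗ X.unmop] = (ε[Y.unmop] ⊗ₘ ε[X.unmop]) ≫ (ρ_ (𝟙_ C)).hom
    rw [MonoidalDiscard.discard_tensor, unitors_equal])
  discard_unit := Quiver.Hom.unmop_inj MonoidalDiscard.discard_unit

instance [CopyDiscardCategory C] : MonoidalDiscard C where
  discard_tensor := CopyDiscardCategory.discard_tensor
  discard_unit := CopyDiscardCategory.discard_unit

end RightHanded

/-- The left-handed construction. -/
abbrev CCoparaL (C : Type u) := CCopara C

/-- The right-handed construction, where the coparameter is on the right of the codomain: the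
left-handed one for the category with reversed tensor product. A 1-cell from `rightObj A` to
`rightObj B` with coparameter `M` is a morphism `A ⟶ B ⊗ M` of `C`. -/
abbrev CCoparaR (C : Type u) := CCopara Cᴹᵒᵖ

/-- An object of `C` as a 0-cell of the right-handed construction. -/
abbrev rightObj {C : Type u} (A : C) : CCoparaR C := CCopara.of (.mop A)

/-- Discard the coparameter of a right-handed 1-cell. -/
def discardR {C : Type u} [Category.{v} C] [MonoidalCategory C] [∀ X : C, ComonObj X] {A B : C}
    (f : rightObj A ⟶ rightObj B) : A ⟶ B :=
  (CCopara.Hom.discard f).unmop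

/-! ### Bayesian lenses -/

/-- 0-cells of the bicategory of Bayesian lenses: pairs of objects. -/
structure BayesLens (C : Type u) where
  fst : C
  snd : C

namespace BayesLens

variable {C : Type u} [Category.{v} C] [MonoidalCategory C]

section
variable [∀ X : C, ComonObj X]

/-- A lens `(X, A) ⟶ (Y, B)` is a left-coparameterized morphism `X ⟶ Y` together with a
right-coparameterized morphism `B ⟶ A` depending on a state of `X`. -/
structure Hom (X Y : BayesLens C) where
  fwd : (CCopara.of X.fst : CCoparaL C) ⟶ CCopara.of Y.fst
  bwd : (𝟙_ C ⟶ X.fst) → (rightObj Y.snd ⟶ rightObj X.snd)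

/-- The action on states of the forward morphism with its coparameter discarded. -/
def Hom.onState {X Y : BayesLens C} (c : Hom X Y) (π : 𝟙_ C ⟶ X.fst) : 𝟙_ C ⟶ Y.fst :=
  π ≫ CCopara.Hom.discard c.fwd

/-- A 2-cell of lenses: a 2-cell between the forward morphisms, and for each state a 2-cell between
the backward morphisms. -/
@[ext]
structure Hom₂ {X Y : BayesLens C} (c d : Hom X Y) where
  fwd : c.fwd ⟶ d.fwd
  bwd (π : 𝟙_ C ⟶ X.fst) : c.bwd π ⟶ d.bwd π

/-- The backward part of a composite lens at the state `π` is the backward part of the second lens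
at the pushforward of `π`, followed by that of the first lens at `π`. -/
instance : CategoryStruct (BayesLens C) where
  Hom := Hom
  id X := ⟨𝟙 _, fun _ => 𝟙 _⟩
  comp c d := ⟨c.fwd ≫ d.fwd, fun π => d.bwd (c.onState π) ≫ c.bwd π⟩

instance (X Y : BayesLens C) : Category (X ⟶ Y) where
  Hom c d := Hom₂ c d
  id c := ⟨𝟙 _, fun _ => 𝟙 _⟩
  comp α β := ⟨α.fwd ≫ β.fwd, fun π => α.bwd π ≫ β.bwd π⟩
  id_comp _ := Hom₂.ext (Category.id_comp _) (funext fun _ => Category.id_comp _)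
  comp_id _ := Hom₂.ext (Category.comp_id _) (funext fun _ => Category.comp_id _)
  assoc _ _ _ := Hom₂.ext (Category.assoc _ _ _) (funext fun _ => Category.assoc _ _ _)

lemma onState_eq {X Y : BayesLens C} {c d : X ⟶ Y} (α : c ⟶ d) : c.onState = d.onState := by
  funext π
  exact congrArg (π ≫ ·) α.fwd.discard

lemma bwd_eqToHom {X Y : BayesLens C} {c d : X ⟶ Y} (α : c ⟶ d) {π π' : 𝟙_ C ⟶ X.fst}
    (h : π = π') :
    α.bwd π ≫ eqToHom (congrArg d.bwd h) = eqToHom (congrArg c.bwd h) ≫ α.bwd π' := by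
  subst h; simp

end

variable [∀ X : C, ComonObj X] [MonoidalDiscard C]

lemma onState_id (X : BayesLens C) (π : 𝟙_ C ⟶ X.fst) : Hom.onState (𝟙 X) π = π := by
  have h : CCopara.Hom.discard (𝟙 (CCopara.of X.fst : CCoparaL C)) = 𝟙 X.fst :=
    CCopara.discard_id _
  exact (congrArg (π ≫ ·) h).trans (Category.comp_id π)

lemma onState_comp {X Y Z : BayesLens C} (c : X ⟶ Y) (d : Y ⟶ Z) (π : 𝟙_ C ⟶ X.fst) :
    Hom.onState (c ≫ d) π = d.onState (c.onState π) :=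
  (congrArg (π ≫ ·) (CCopara.discard_comp c.fwd d.fwd)).trans (Category.assoc _ _ _).symm

/-- Horizontal composition of 2-cells of lenses. The transport identifies the states obtained by
pushing forward along `c` and along `c'`, which agree as there is a 2-cell `c ⟶ c'`. -/
def hcomp {X Y Z : BayesLens C} {c c' : X ⟶ Y} {d d' : Y ⟶ Z} (α : c ⟶ c') (β : d ⟶ d') :
    c ≫ d ⟶ c' ≫ d' :=
  ⟨BicategoryData.hcomp α.fwd β.fwd, fun π =>
    BicategoryData.hcomp
      (β.bwd (c.onState π) ≫ eqToHom (congrArg d'.bwd (congrFun (onState_eq α) π))) (α.bwd π)⟩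

lemma hcomp_id {X Y Z : BayesLens C} (c : X ⟶ Y) (d : Y ⟶ Z) : hcomp (𝟙 c) (𝟙 d) = 𝟙 (c ≫ d) := by
  refine Hom₂.ext (BicategoryData.hcomp_id _ _) (funext fun π => ?_)
  have h : ((𝟙 d : d ⟶ d).bwd (c.onState π)) ≫ eqToHom rfl = 𝟙 (d.bwd (c.onState π)) :=
    Category.comp_id _
  exact (congrArg (fun t => BicategoryData.hcomp t (𝟙 (c.bwd π))) h).trans
    (BicategoryData.hcomp_id _ _)

lemma hcomp_comp {X Y Z : BayesLens C} {c c' c'' : X ⟶ Y} {d d' d'' : Y ⟶ Z}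
    (α : c ⟶ c') (α' : c' ⟶ c'') (β : d ⟶ d') (β' : d' ⟶ d'') :
    hcomp (α ≫ α') (β ≫ β') = hcomp α β ≫ hcomp α' β' := by
  refine Hom₂.ext (BicategoryData.hcomp_comp _ _ _ _) (funext fun π => ?_)
  refine Eq.trans ?_ (BicategoryData.hcomp_comp _ _ _ _)
  have e := bwd_eqToHom β' (congrFun (onState_eq α) π)
  refine congrArg (fun t => BicategoryData.hcomp t (α.bwd π ≫ α'.bwd π)) ?_
  change (β.bwd _ ≫ β'.bwd _) ≫ eqToHom _ = (β.bwd _ ≫ eqToHom _) ≫ β'.bwd _ ≫ eqToHom _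
  rw [Category.assoc, Category.assoc, ← reassoc_of% e, eqToHom_trans]

/-- The 2-cell identifying a backward morphism at two equal states. -/
def bwdCast {X Y : BayesLens C} (c : X ⟶ Y) {π π' : 𝟙_ C ⟶ X.fst} (h : π = π') :
    c.bwd π ≅ c.bwd π' :=
  eqToIso (congrArg c.bwd h)

/-- Horizontal composition of an invertible 2-cell with an identity. -/
def whiskerIso {D : Type u} [BicategoryData D] {X Y Z : D} {f f' : X ⟶ Y} (e : f ≅ f')
    (g : Y ⟶ Z) : f ≫ g ≅ f' ≫ g where
  hom := BicategoryData.hcomp e.hom (𝟙 g)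
  inv := BicategoryData.hcomp e.inv (𝟙 g)
  hom_inv_id := by rw [← BicategoryData.hcomp_comp]; simp [BicategoryData.hcomp_id]
  inv_hom_id := by rw [← BicategoryData.hcomp_comp]; simp [BicategoryData.hcomp_id]

/-- The backward part of the associator. -/
def assocBwd {W X Y Z : BayesLens C} (c : W ⟶ X) (d : X ⟶ Y) (e : Y ⟶ Z) (π : 𝟙_ C ⟶ W.fst) :
    ((c ≫ d) ≫ e).bwd π ≅ (c ≫ d ≫ e).bwd π :=
  whiskerIso (bwdCast e (onState_comp c d π)) _ ≪≫
    (BicategoryData.assoc (e.bwd (d.onState (c.onState π))) (d.bwd (c.onState π)) (c.bwd π)).symm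

/-- The associator of lenses. -/
def associator {W X Y Z : BayesLens C} (c : W ⟶ X) (d : X ⟶ Y) (e : Y ⟶ Z) :
    (c ≫ d) ≫ e ≅ c ≫ d ≫ e where
  hom := ⟨(BicategoryData.assoc c.fwd d.fwd e.fwd).hom, fun π => (assocBwd c d e π).hom⟩
  inv := ⟨(BicategoryData.assoc c.fwd d.fwd e.fwd).inv, fun π => (assocBwd c d e π).inv⟩
  hom_inv_id := Hom₂.ext (BicategoryData.assoc _ _ _).hom_inv_id
    (funext fun π => (assocBwd c d e π).hom_inv_id)
  inv_hom_id := Hom₂.ext (BicategoryData.assoc _ _ _).inv_hom_id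
    (funext fun π => (assocBwd c d e π).inv_hom_id)

instance : BicategoryData (BayesLens C) where
  homCategory X Y := inferInstance
  hcomp := hcomp
  hcomp_id := hcomp_id
  hcomp_comp := hcomp_comp
  assoc := associator
  unitL {X Y} c := ⟨BicategoryData.unitL c.fwd, fun π =>
    BicategoryData.unitR (c.bwd (Hom.onState (𝟙 X) π)) ≫ (bwdCast c (onState_id X π)).hom⟩
  unitR c := ⟨BicategoryData.unitR c.fwd, fun π => BicategoryData.unitL (c.bwd π)⟩

end BayesLens

/-! ### Bilinear effects -/

/-- A copy-discard category has bilinear effects when its effects, the morphisms to the unit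
object, can be summed: `add` is natural with respect to discard-preserving morphisms, makes the
effects into a commutative monoid with unit `zero`, and sums of effects (with or without summands)
are preserved by precomposition with arbitrary morphisms. -/
class BilinearEffects (C : Type u) [Category.{v} C] [MonoidalCategory C]
    [CopyDiscardCategory C] where
  add {A B : C} (g : A ⟶ 𝟙_ C) (h : B ⟶ 𝟙_ C) : A ⊗ B ⟶ 𝟙_ C
  zero : 𝟙_ C ⟶ 𝟙_ C
  add_natural {A A' B B' : C} (f : A' ⟶ A) (f' : B' ⟶ B) (g : A ⟶ 𝟙_ C) (h : B ⟶ 𝟙_ C)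
    (hf : f ≫ ε[A] = ε[A']) (hf' : f' ≫ ε[B] = ε[B']) :
    add (f ≫ g) (f' ≫ h) = (f ⊗ₘ f') ≫ add g h
  add_assoc {A B D : C} (g : A ⟶ 𝟙_ C) (h : B ⟶ 𝟙_ C) (k : D ⟶ 𝟙_ C) :
    (α_ A B D).hom ≫ add g (add h k) = add (add g h) k
  add_comm {A B : C} (g : A ⟶ 𝟙_ C) (h : B ⟶ 𝟙_ C) : (β_ A B).hom ≫ add h g = add g h
  add_zero {A : C} (g : A ⟶ 𝟙_ C) : (ρ_ A).inv ≫ add g zero = g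
  bilinear {A B : C} (f : A ⟶ B) (g g' : B ⟶ 𝟙_ C) :
    f ≫ Δ[B] ≫ add g g' = Δ[A] ≫ add (f ≫ g) (f ≫ g')
  bilinear_zero {A B : C} (f : A ⟶ B) : f ≫ ε[B] ≫ zero = ε[A] ≫ zero

section Effects

lemma copy_total {C : Type u} [Category.{v} C] [MonoidalCategory C] [∀ X : C, ComonObj X]
    [MonoidalDiscard C] (A : C) : Δ[A] ≫ ε[A ⊗ A] = ε[A] := by
  rw [MonoidalDiscard.discard_tensor, MonoidalCategory.tensorHom_def]
  simp

variable {C : Type u} [Category.{v} C] [MonoidalCategory C] [CopyDiscardCategory C]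

/-- The effects on `B`. -/
def Effect (B : C) : Type v := B ⟶ 𝟙_ C

variable [BilinearEffects C]

open BilinearEffects

lemma effect_add_comm {B : C} (g h : B ⟶ 𝟙_ C) : Δ[B] ≫ add g h = Δ[B] ≫ add h g := by
  rw [← BilinearEffects.add_comm g h, ← Category.assoc, IsCommComonObj.comul_comm]

lemma effect_add_assoc {B : C} (g h k : B ⟶ 𝟙_ C) :
    Δ[B] ≫ add (Δ[B] ≫ add g h) k = Δ[B] ≫ add g (Δ[B] ≫ add h k) := by
  have e1 := add_natural Δ[B] (𝟙 B) (add g h) k (copy_total B) (Category.id_comp _)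
  have e2 := add_natural (𝟙 B) Δ[B] g (add h k) (Category.id_comp _) (copy_total B)
  rw [Category.id_comp] at e1 e2
  rw [e1, e2, ← BilinearEffects.add_assoc, tensorHom_id, id_tensorHom, comul_assoc_assoc]

lemma effect_add_zero {B : C} (g : B ⟶ 𝟙_ C) : Δ[B] ≫ add g (ε[B] ≫ zero) = g := by
  have e := add_natural (𝟙 B) ε[B] g zero (Category.id_comp _)
    (by rw [CopyDiscardCategory.discard_unit, Category.comp_id])
  rw [Category.id_comp] at e
  rw [e, id_tensorHom, comul_counit_assoc, BilinearEffects.add_zero]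

/-- Effects on `B` are summed by copying `B`; the zero effect discards `B`. -/
instance (B : C) : Zero (Effect B) where
  zero := ε[B] ≫ BilinearEffects.zero

instance (B : C) : Add (Effect B) where
  add g g' := Δ[B] ≫ BilinearEffects.add g g'

instance (B : C) : AddCommMonoid (Effect B) where
  nsmul := nsmulRec
  add_assoc := effect_add_assoc
  add_comm := effect_add_comm
  zero_add g := (effect_add_comm _ _).trans (effect_add_zero g)
  add_zero := effect_add_zero

/-- Precomposition of effects with a morphism, which preserves sums. -/
def Effect.precomp {A B : C} (f : A ⟶ B) : Effect B →+ Effect A where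
  toFun g := f ≫ g
  map_zero' := BilinearEffects.bilinear_zero f
  map_add' g g' := BilinearEffects.bilinear f g g'

/-- The losses of type `(X, A) ⟶ (Y, B)`: effects on `B` depending on a state of `X`, summed
statewise. -/
abbrev Loss (X B : C) : Type v := (𝟙_ C ⟶ X) → Effect B

end Effects

/-! ### Statistical games -/

/-- 0-cells of the bicategory of statistical games: the 0-cells of the bicategory of lenses. -/
structure SGame (C : Type u) where
  of ::
  toLens : BayesLens C

namespace SGame

variable {C : Type u} [Category.{v} C] [MonoidalCategory C] [CopyDiscardCategory C]
  [BilinearEffects C]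

/-- The loss `L^d_c + L^c ∘ d'_c` of a composite of lenses `c`, `d` with losses `K`, `K'`, where
`d'` is the backward part of `d`: the second loss is evaluated at the pushforward of the state, and
the first one after the backward part of the second lens with its coparameter discarded. -/
def compLoss {X Y Z : BayesLens C} (c : X ⟶ Y) (d : Y ⟶ Z) (K : Loss X.fst Y.snd)
    (K' : Loss Y.fst Z.snd) : Loss X.fst Z.snd := fun π =>
  K' (c.onState π) + Effect.precomp (discardR (d.bwd (c.onState π))) (K π)

lemma compLoss_add {X Y Z : BayesLens C} (c : X ⟶ Y) (d : Y ⟶ Z) (K L : Loss X.fst Y.snd)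
    (K' L' : Loss Y.fst Z.snd) :
    compLoss c d (K + L) (K' + L') = compLoss c d K K' + compLoss c d L L' := by
  funext π
  simp only [compLoss, Pi.add_apply, map_add]
  exact add_add_add_comm _ _ _ _

lemma compLoss_zero {X Y Z : BayesLens C} (c : X ⟶ Y) (d : Y ⟶ Z) :
    compLoss c d 0 0 = 0 := by
  funext π
  simp [compLoss]

lemma compLoss_congr {X Y Z : BayesLens C} {c c' : X ⟶ Y} {d d' : Y ⟶ Z} (α : c ⟶ c')
    (β : d ⟶ d') (K : Loss X.fst Y.snd) (K' : Loss Y.fst Z.snd) :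
    compLoss c d K K' = compLoss c' d' K K' := by
  funext π
  have h1 := congrFun (BayesLens.onState_eq α) π
  have h2 : ∀ s, discardR (d.bwd s) = discardR (d'.bwd s) := fun s =>
    congrArg Quiver.Hom.unmop (β.bwd s).discard
  simp only [compLoss, h1, h2]

/-- A statistical game: a lens with a loss. -/
structure Hom (X Y : SGame C) where
  lens : X.toLens ⟶ Y.toLens
  loss : Loss X.toLens.fst Y.toLens.snd

/-- A 2-cell of statistical games: a 2-cell of lenses with a loss accounting for the difference of
the losses. -/
@[ext]
structure Hom₂ {X Y : SGame C} (f g : Hom X Y) where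
  cell : f.lens ⟶ g.lens
  loss : Loss X.toLens.fst Y.toLens.snd
  loss_eq : f.loss = g.loss + loss

instance : CategoryStruct (SGame C) where
  Hom X Y := Hom X Y
  id X := ⟨𝟙 X.toLens, 0⟩
  comp f g := ⟨f.lens ≫ g.lens, compLoss f.lens g.lens f.loss g.loss⟩

instance (X Y : SGame C) : Category (X ⟶ Y) where
  Hom f g := Hom₂ f g
  id f := ⟨𝟙 f.lens, 0, (add_zero _).symm⟩
  comp α β := ⟨α.cell ≫ β.cell, β.loss + α.loss, by
    rw [α.loss_eq, β.loss_eq, add_assoc]⟩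
  id_comp _ := Hom₂.ext (Category.id_comp _) (add_zero _)
  comp_id _ := Hom₂.ext (Category.comp_id _) (zero_add _)
  assoc _ _ _ := Hom₂.ext (Category.assoc _ _ _) (add_assoc _ _ _).symm

/-- Horizontal composition of 2-cells of statistical games. -/
def hcomp {X Y Z : SGame C} {f f' : X ⟶ Y} {g g' : Y ⟶ Z} (α : f ⟶ f') (β : g ⟶ g') :
    f ≫ g ⟶ f' ≫ g' :=
  ⟨BicategoryData.hcomp α.cell β.cell, compLoss f.lens g.lens α.loss β.loss, by
    change compLoss f.lens g.lens f.loss g.loss =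
      compLoss f'.lens g'.lens f'.loss g'.loss + compLoss f.lens g.lens α.loss β.loss
    rw [α.loss_eq, β.loss_eq, compLoss_add, compLoss_congr α.cell β.cell f'.loss g'.loss]⟩

lemma assoc_loss {W X Y Z : SGame C} (f : W ⟶ X) (g : X ⟶ Y) (h : Y ⟶ Z) :
    ((f ≫ g) ≫ h).loss = (f ≫ g ≫ h).loss := by
  funext π
  have h1 := BayesLens.onState_comp f.lens g.lens π
  have h2 : ∀ s, discardR ((g.lens ≫ h.lens).bwd s) =
      discardR (h.lens.bwd (g.lens.onState s)) ≫ discardR (g.lens.bwd s) := fun s =>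
    congrArg Quiver.Hom.unmop (CCopara.discard_comp _ _)
  change h.loss (BayesLens.Hom.onState (f.lens ≫ g.lens) π) + Effect.precomp (discardR (h.lens.bwd
      (BayesLens.Hom.onState (f.lens ≫ g.lens) π)))
        (g.loss (f.lens.onState π) + Effect.precomp (discardR (g.lens.bwd (f.lens.onState π)))
          (f.loss π)) =
    (h.loss (g.lens.onState (f.lens.onState π)) +
      Effect.precomp (discardR (h.lens.bwd (g.lens.onState (f.lens.onState π))))
        (g.loss (f.lens.onState π))) +
      Effect.precomp (discardR ((g.lens ≫ h.lens).bwd (f.lens.onState π))) (f.loss π)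
  rw [h1, h2, map_add, add_assoc]
  congr 2
  exact (Category.assoc _ _ _).symm

lemma unitL_loss {X Y : SGame C} (f : X ⟶ Y) : (𝟙 X ≫ f).loss = f.loss := by
  funext π
  change f.loss (BayesLens.Hom.onState (𝟙 X.toLens) π) + Effect.precomp _ 0 = f.loss π
  rw [BayesLens.onState_id, map_zero, add_zero]

lemma unitR_loss {X Y : SGame C} (f : X ⟶ Y) : (f ≫ 𝟙 Y).loss = f.loss := by
  funext π
  have h : discardR (𝟙 (rightObj (Y.toLens.snd))) = 𝟙 _ :=
    congrArg Quiver.Hom.unmop (CCopara.discard_id _)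
  change 0 + Effect.precomp (discardR (𝟙 (rightObj (Y.toLens.snd)))) (f.loss π) = f.loss π
  rw [h, zero_add]
  exact Category.id_comp _

instance : BicategoryData (SGame C) where
  homCategory X Y := inferInstance
  hcomp := hcomp
  hcomp_id f g := Hom₂.ext (BicategoryData.hcomp_id f.lens g.lens) (compLoss_zero _ _)
  hcomp_comp {X Y Z f f' f'' g g' g''} α α' β β' :=
    Hom₂.ext (BicategoryData.hcomp_comp _ _ _ _) (by
      change compLoss f.lens g.lens (α'.loss + α.loss) (β'.loss + β.loss) =
        compLoss f'.lens g'.lens α'.loss β'.loss + compLoss f.lens g.lens α.loss β.loss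
      rw [compLoss_add, compLoss_congr α.cell β.cell α'.loss β'.loss])
  assoc f g h :=
    { hom := ⟨(BicategoryData.assoc f.lens g.lens h.lens).hom, 0,
        (assoc_loss f g h).trans (add_zero _).symm⟩
      inv := ⟨(BicategoryData.assoc f.lens g.lens h.lens).inv, 0,
        (assoc_loss f g h).symm.trans (add_zero _).symm⟩
      hom_inv_id := Hom₂.ext (BicategoryData.assoc f.lens g.lens h.lens).hom_inv_id (add_zero 0)
      inv_hom_id := Hom₂.ext (BicategoryData.assoc f.lens g.lens h.lens).inv_hom_id (add_zero 0) }
  unitL f := ⟨BicategoryData.unitL f.lens, 0, (unitL_loss f).trans (add_zero _).symm⟩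
  unitR f := ⟨BicategoryData.unitR f.lens, 0, (unitR_loss f).trans (add_zero _).symm⟩

/-- The statistical games over a subbicategory of lenses. -/
def above (B : SubBicategory (BayesLens C)) : SubBicategory (SGame C) where
  obj X := B.obj X.toLens
  hom f := B.hom f.lens
  cell α := B.cell α.cell
  src_mem := B.src_mem
  tgt_mem := B.tgt_mem
  src_mem₂ := B.src_mem₂
  tgt_mem₂ := B.tgt_mem₂
  id_mem := B.id_mem
  comp_mem := B.comp_mem
  id_mem₂ := B.id_mem₂
  comp_mem₂ := B.comp_mem₂
  hcomp_mem := B.hcomp_mem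
  assoc_mem := B.assoc_mem
  assoc_inv_mem := B.assoc_inv_mem
  unitL_mem := B.unitL_mem
  unitR_mem := B.unitR_mem

end SGame

/-! ### Loss models -/

section LossModels

variable {C : Type u} [Category.{v} C] [MonoidalCategory C] [CopyDiscardCategory C]
  [BilinearEffects C]

/-- The projection from statistical games to lenses, which forgets the losses, restricted to a
subbicategory of lenses. -/
def projOn (B : SubBicategory (BayesLens C)) : LaxFun (SGame.above B).Obj B.Obj where
  obj X := ⟨X.1.toLens, X.2⟩
  map f := ⟨f.1.lens, f.2⟩
  map₂ α := ⟨α.1.cell, α.2⟩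
  mapId _ := 𝟙 _
  mapComp _ _ := 𝟙 _
  map₂_id _ := rfl
  map₂_comp _ _ := rfl
  mapComp_naturality α β := SubBicategory.Cell.ext
    ((Category.id_comp _).trans (Category.comp_id _).symm)
  map₂_assoc f g h := by
    rw [BicategoryData.hcomp_id, BicategoryData.hcomp_id]
    exact SubBicategory.Cell.ext ((Category.id_comp _).trans ((Category.id_comp _).trans
      ((Category.comp_id _).symm.trans (congrArg _ (Category.comp_id _).symm))))
  map₂_unitL f := by
    rw [BicategoryData.hcomp_id]
    exact (Category.id_comp _).trans (Category.id_comp _)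
  map₂_unitR f := by
    rw [BicategoryData.hcomp_id]
    exact (Category.id_comp _).trans (Category.id_comp _)

/-- The losses making up an assignment of statistical games to the lenses in `B`: a loss for each
lens, a loss for each 2-cell, and a loss for each unit and composition constraint. The equations
say that these are the losses of 2-cells of statistical games. -/
@[ext]
structure LossData (B : SubBicategory (BayesLens C)) where
  loss {X Y : B.Obj} (c : X ⟶ Y) : Loss X.1.fst Y.1.snd
  cellLoss {X Y : B.Obj} {c d : X ⟶ Y} (α : c ⟶ d) : Loss X.1.fst Y.1.snd
  idLoss (X : B.Obj) : Loss X.1.fst X.1.snd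
  compLoss {X Y Z : B.Obj} (c : X ⟶ Y) (d : Y ⟶ Z) : Loss X.1.fst Z.1.snd
  cell_eq {X Y : B.Obj} {c d : X ⟶ Y} (α : c ⟶ d) : loss c = loss d + cellLoss α
  id_eq (X : B.Obj) : 0 = loss (𝟙 X) + idLoss X
  comp_eq {X Y Z : B.Obj} (c : X ⟶ Y) (d : Y ⟶ Z) :
    SGame.compLoss c.1 d.1 (loss c) (loss d) = loss (c ≫ d) + compLoss c d

namespace LossData

variable {B : SubBicategory (BayesLens C)} (L : LossData B)

/-- A 0-cell of `B` as a 0-cell of games over `B`. -/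
def obj (X : B.Obj) : (SGame.above B).Obj := ⟨.of X.1, X.2⟩

/-- The statistical game assigned to a lens. -/
def map {X Y : B.Obj} (c : X ⟶ Y) : obj X ⟶ obj Y := ⟨⟨c.1, L.loss c⟩, c.2⟩

/-- The 2-cell of statistical games assigned to a 2-cell of lenses. -/
def map₂ {X Y : B.Obj} {c d : X ⟶ Y} (α : c ⟶ d) : L.map c ⟶ L.map d :=
  ⟨⟨α.1, L.cellLoss α, L.cell_eq α⟩, α.2⟩

/-- The unit constraint, lying over the identity. -/
def mapId (X : B.Obj) : 𝟙 (obj X) ⟶ L.map (𝟙 X) :=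
  ⟨⟨𝟙 (𝟙 X.1), L.idLoss X, L.id_eq X⟩, B.id_mem₂ (B.id_mem X.2)⟩

/-- The composition constraint, lying over the identity. -/
def mapComp {X Y Z : B.Obj} (c : X ⟶ Y) (d : Y ⟶ Z) : L.map c ≫ L.map d ⟶ L.map (c ≫ d) :=
  ⟨⟨𝟙 (c.1 ≫ d.1), L.compLoss c d, L.comp_eq c d⟩, B.id_mem₂ (B.comp_mem c.2 d.2)⟩

end LossData

/-- A loss model for `B`: a lax section of the projection from statistical games to lenses,
restricted to `B`. Such a section is the identity on 0-cells and on the lens parts of all cells and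
constraints, so it is given by its losses; see `LossModel.toLaxFun`,
`LossModel.toLaxFun_isSection` and `LossModel.existsUnique_of_isSection`. -/
@[ext]
structure LossModel (B : SubBicategory (BayesLens C)) extends LossData B where
  map₂_id {X Y : B.Obj} (c : X ⟶ Y) : toLossData.map₂ (𝟙 c) = 𝟙 (toLossData.map c)
  map₂_comp {X Y : B.Obj} {c d e : X ⟶ Y} (α : c ⟶ d) (β : d ⟶ e) :
    toLossData.map₂ (α ≫ β) = toLossData.map₂ α ≫ toLossData.map₂ β
  mapComp_naturality {X Y Z : B.Obj} {c c' : X ⟶ Y} {d d' : Y ⟶ Z} (α : c ⟶ c') (β : d ⟶ d') :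
    toLossData.mapComp c d ≫ toLossData.map₂ (hcomp α β) =
      hcomp (toLossData.map₂ α) (toLossData.map₂ β) ≫ toLossData.mapComp c' d'
  map₂_assoc {W X Y Z : B.Obj} (c : W ⟶ X) (d : X ⟶ Y) (e : Y ⟶ Z) :
    hcomp (toLossData.mapComp c d) (𝟙 (toLossData.map e)) ≫ toLossData.mapComp (c ≫ d) e ≫
        toLossData.map₂ (assoc c d e).hom =
      (assoc (toLossData.map c) (toLossData.map d) (toLossData.map e)).hom ≫
        hcomp (𝟙 (toLossData.map c)) (toLossData.mapComp d e) ≫ toLossData.mapComp c (d ≫ e)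
  map₂_unitL {X Y : B.Obj} (c : X ⟶ Y) :
    hcomp (toLossData.mapId X) (𝟙 (toLossData.map c)) ≫ toLossData.mapComp (𝟙 X) c ≫
      toLossData.map₂ (unitL c) = unitL (toLossData.map c)
  map₂_unitR {X Y : B.Obj} (c : X ⟶ Y) :
    hcomp (𝟙 (toLossData.map c)) (toLossData.mapId Y) ≫ toLossData.mapComp c (𝟙 Y) ≫
      toLossData.map₂ (unitR c) = unitR (toLossData.map c)

namespace LossModel

variable {B : SubBicategory (BayesLens C)}

/-- The lax functor from `B` to statistical games over `B` given by a loss model. -/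
def toLaxFun (L : LossModel B) : LaxFun B.Obj (SGame.above B).Obj where
  obj := LossData.obj
  map := L.map
  map₂ := L.map₂
  mapId := L.mapId
  mapComp := L.mapComp
  map₂_id := L.map₂_id
  map₂_comp := L.map₂_comp
  mapComp_naturality := L.mapComp_naturality
  map₂_assoc := L.map₂_assoc
  map₂_unitL := L.map₂_unitL
  map₂_unitR := L.map₂_unitR

/-- A lax functor from `B` to games over `B` is a section when its composite with the projection is
the identity. -/
def IsSection (F : LaxFun B.Obj (SGame.above B).Obj) : Prop :=
  F.comp (projOn B) = LaxFun.id B.Obj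

theorem toLaxFun_isSection (L : LossModel B) : IsSection L.toLaxFun :=
  LaxFun.mk_eq (LaxFun.id B.Obj) (LaxFun.comp L.toLaxFun (projOn B)).mapId
    (LaxFun.comp L.toLaxFun (projOn B)).mapComp
    (funext fun X => SubBicategory.Cell.ext (Category.comp_id (𝟙 (𝟙 X.1))))
    (funext fun _ => funext fun _ => funext fun _ => funext fun c => funext fun d =>
      SubBicategory.Cell.ext (Category.comp_id (𝟙 (c.1 ≫ d.1))))
    (LaxFun.comp L.toLaxFun (projOn B)).map₂_id (LaxFun.comp L.toLaxFun (projOn B)).map₂_comp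
    (LaxFun.comp L.toLaxFun (projOn B)).mapComp_naturality
    (LaxFun.comp L.toLaxFun (projOn B)).map₂_assoc
    (LaxFun.comp L.toLaxFun (projOn B)).map₂_unitL
    (LaxFun.comp L.toLaxFun (projOn B)).map₂_unitR

theorem toLaxFun_injective {L M : LossModel B} (h : L.toLaxFun = M.toLaxFun) : L = M := by
  obtain ⟨⟨l, cl, il, kl, h1, h2, h3⟩, _, _, _, _, _, _⟩ := L
  obtain ⟨⟨l', cl', il', kl', h1', h2', h3'⟩, _, _, _, _, _, _⟩ := M
  unfold toLaxFun at h
  simp only [LaxFun.mk.injEq] at h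
  obtain ⟨-, hm, hc, hi, hk⟩ := h
  have e1 : @l = @l' := by
    funext X Y c
    exact congrArg (fun t => t.1.loss) (congrFun (congrFun (congrFun (eq_of_heq hm) X) Y) c)
  subst e1
  have e2 : @cl = @cl' := by
    funext X Y c d α
    have := congrFun (congrFun (congrFun (congrFun (congrFun (eq_of_heq hc) X) Y) c) d) α
    exact congrArg (fun t => t.1.loss) this
  have e3 : @il = @il' := by
    funext X
    have := congrFun (eq_of_heq hi) X
    exact congrArg (fun t => t.1.loss) this
  have e4 : @kl = @kl' := by
    funext X Y Z c d
    have := congrFun (congrFun (congrFun (congrFun (congrFun (eq_of_heq hk) X) Y) Z) c) d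
    exact congrArg (fun t => t.1.loss) this
  subst e2 e3 e4
  rfl

theorem existsUnique_of_isSection (F : LaxFun B.Obj (SGame.above B).Obj) (hF : IsSection F) :
    ∃! L : LossModel B, L.toLaxFun = F := by
  refine existsUnique_of_exists_of_unique ?_
    fun L M h h' => toLaxFun_injective (h.trans h'.symm)
  rcases F with ⟨obj, map, map₂, mapId, mapComp, a1, a2, a3, a4, a5, a6⟩
  unfold IsSection LaxFun.comp LaxFun.id at hF
  simp only [LaxFun.mk.injEq] at hF
  obtain ⟨h1, hm, hc, hi, hk⟩ := hF
  have e : obj = LossData.obj := by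
    funext X
    have := congrFun h1 X
    exact congrArg (fun t : B.Obj => (⟨.of t.1, t.2⟩ : (SGame.above B).Obj)) this
  subst e
  have e : ∃ l : ∀ {X Y : B.Obj} (c : X ⟶ Y), Loss X.1.fst Y.1.snd,
      @map = fun {X Y} c => ⟨⟨c.1, l c⟩, c.2⟩ := by
    have e' : ∀ {X Y : B.Obj} (c : X ⟶ Y), ∃ l, map c = ⟨⟨c.1, l⟩, c.2⟩ := by
      intro X Y c
      have := congrFun (congrFun (congrFun (eq_of_heq hm) X) Y) c
      have h : (map c).1.lens = c.1 := congrArg (fun t => t.1) this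
      rcases hmc : map c with ⟨⟨a, b⟩, m⟩
      rw [hmc] at h
      dsimp at h
      subst h
      exact ⟨b, rfl⟩
    choose l hl using @e'
    exact ⟨l, funext fun X => funext fun Y => funext fun c => hl c⟩
  obtain ⟨l, rfl⟩ := e
  have e : ∃ (cl : ∀ {X Y : B.Obj} {c d : X ⟶ Y} (α : c ⟶ d), Loss X.1.fst Y.1.snd)
      (h : ∀ {X Y : B.Obj} {c d : X ⟶ Y} (α : c ⟶ d), l c = l d + cl α),
      @map₂ = fun {X Y c d} α => ⟨⟨α.1, cl α, h α⟩, α.2⟩ := by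
    refine ⟨fun α => (map₂ α).1.loss, fun α => (map₂ α).1.loss_eq, ?_⟩
    funext X Y c d α
    have := congrFun (congrFun (congrFun (congrFun (congrFun (eq_of_heq hc) X) Y) c) d) α
    exact SubBicategory.Cell.ext (SGame.Hom₂.ext (congrArg (fun t => t.1) this) rfl)
  obtain ⟨cl, h1, rfl⟩ := e
  have e : ∃ (il : ∀ (X : B.Obj), Loss X.1.fst X.1.snd)
      (h : ∀ (X : B.Obj), 0 = l (𝟙 X) + il X),
      mapId = fun X => ⟨⟨𝟙 (𝟙 X.1), il X, h X⟩, B.id_mem₂ (B.id_mem X.2)⟩ := by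
    refine ⟨fun X => (mapId X).1.loss, fun X => (mapId X).1.loss_eq, ?_⟩
    funext X
    have := congrFun (eq_of_heq hi) X
    have h : 𝟙 (𝟙 X.1) ≫ (mapId X).1.cell = 𝟙 (𝟙 X.1) := congrArg (fun t => t.1) this
    exact SubBicategory.Cell.ext (SGame.Hom₂.ext ((Category.id_comp _).symm.trans h) rfl)
  obtain ⟨il, h2, rfl⟩ := e
  have e : ∃ (kl : ∀ {X Y Z : B.Obj} (c : X ⟶ Y) (d : Y ⟶ Z), Loss X.1.fst Z.1.snd)
      (h : ∀ {X Y Z : B.Obj} (c : X ⟶ Y) (d : Y ⟶ Z),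
        SGame.compLoss c.1 d.1 (l c) (l d) = l (c ≫ d) + kl c d),
      @mapComp = fun {X Y Z} c d => ⟨⟨𝟙 (c.1 ≫ d.1), kl c d, h c d⟩,
        B.id_mem₂ (B.comp_mem c.2 d.2)⟩ := by
    refine ⟨fun c d => (mapComp c d).1.loss, fun c d => (mapComp c d).1.loss_eq, ?_⟩
    funext X Y Z c d
    have := congrFun (congrFun (congrFun (congrFun (congrFun (eq_of_heq hk) X) Y) Z) c) d
    have h : 𝟙 (c.1 ≫ d.1) ≫ (mapComp c d).1.cell = 𝟙 (c.1 ≫ d.1) := congrArg (fun t => t.1) this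
    exact SubBicategory.Cell.ext (SGame.Hom₂.ext ((Category.id_comp _).symm.trans h) rfl)
  obtain ⟨kl, h3, rfl⟩ := e
  exact ⟨⟨⟨l, cl, il, kl, h1, h2, h3⟩, a1, a2, a3, a4, a5, a6⟩, rfl⟩

/-- An icon between loss models: an icon between the lax functors from `B` to statistical games
over `B`. It has a 2-cell for each lens, subject to naturality and to compatibility with the
constraints. -/
@[ext]
structure Icon (L M : LossModel B) where
  app {X Y : B.Obj} (c : X ⟶ Y) : L.map c ⟶ M.map c
  naturality {X Y : B.Obj} {c d : X ⟶ Y} (α : c ⟶ d) :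
    app c ≫ M.map₂ α = L.map₂ α ≫ app d
  unity (X : B.Obj) : L.mapId X ≫ app (𝟙 X) = M.mapId X
  composition {X Y Z : B.Obj} (c : X ⟶ Y) (d : Y ⟶ Z) :
    L.mapComp c d ≫ app (c ≫ d) = hcomp (app c) (app d) ≫ M.mapComp c d

namespace Icon

variable {L M : LossModel B} (η : Icon L M) {X Y : B.Obj} (c : X ⟶ Y)

/-- The 2-cell of `B` underlying a component of an icon. -/
def cell : c ⟶ c := ⟨(η.app c).val.cell, (η.app c).mem⟩

/-- The loss of a component of an icon. -/
def loss : Loss X.1.fst Y.1.snd := (η.app c).val.loss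

end Icon

end LossModel

end LossModels

end StatGame

open StatGame

/-!
The lens parts of a loss model are those of the identity lax functor, so a loss model is a family
of losses satisfying equations, and each of these equations equates two sums of losses and of
values of the horizontal composition formula `SGame.compLoss`. That formula is additive in both
losses together and vanishes on zero (`SGame.compLoss_add`, `SGame.compLoss_zero`), because
precomposition preserves sums of effects. Hence loss models are closed under pointwise sums and
form a commutative monoid (`LossData.IsLax.add`, `LossData.IsLax.zero`).

In the same way an icon is a family of endomorphisms `c ⟶ c` in `B` with a family of losses,
subject to equations that separate into a part on 2-cells and a part on losses. The sum of two
icons composes the 2-cells and adds the losses. For this to be functorial, the 2-cells at `c` of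
two icons `η` and `θ` have to commute. They do, although endomorphisms of `c` need not commute in
general: the 2-cell of `θ` is itself a 2-cell of `B`, and `η` is natural with respect to the
2-cells of `B` (`Icon.cell_comm`).

Since the sum of loss models is strictly associative, unital and commutative, all structure
isomorphisms are induced by equalities of loss models; their 2-cells are identities and their
losses are zero, and every coherence law can be read off from these two facts by `Icon.hom_ext`.
-/

namespace StatGame

open BicategoryData

variable {C : Type u} [Category.{v} C] [MonoidalCategory C] [CopyDiscardCategory C]
  [BilinearEffects C] {B : SubBicategory (BayesLens C)}

/-! ### Two-cells of games as pairs of a 2-cell of lenses and a loss -/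

namespace SGame

/-- A 2-cell of games over `B` is determined by its underlying 2-cell and its loss. -/
lemma above_hom₂_ext {X Y : (SGame.above B).Obj} {f g : X ⟶ Y} {α β : f ⟶ g}
    (hc : α.1.cell = β.1.cell) (hl : α.1.loss = β.1.loss) : α = β :=
  SubBicategory.Cell.ext (Hom₂.ext hc hl)

end SGame

/-! ### Sums of loss models -/

namespace LossData

/-- The equations of a lax functor, read on the losses alone. Their counterparts on the underlying
2-cells of lenses hold for all losses, since a section is the identity there. -/
structure IsLax (D : LossData B) : Prop where
  id {X Y : B.Obj} (c : X ⟶ Y) : D.cellLoss (𝟙 c) = 0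
  comp {X Y : B.Obj} {c d e : X ⟶ Y} (α : c ⟶ d) (β : d ⟶ e) :
    D.cellLoss (α ≫ β) = D.cellLoss β + D.cellLoss α
  naturality {X Y Z : B.Obj} {c c' : X ⟶ Y} {d d' : Y ⟶ Z} (α : c ⟶ c') (β : d ⟶ d') :
    D.cellLoss (hcomp α β) + D.compLoss c d =
      D.compLoss c' d' + SGame.compLoss c.1 d.1 (D.cellLoss α) (D.cellLoss β)
  assoc {W X Y Z : B.Obj} (c : W ⟶ X) (d : X ⟶ Y) (e : Y ⟶ Z) :
    D.cellLoss (BicategoryData.assoc c d e).hom + D.compLoss (c ≫ d) e +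
        SGame.compLoss (c.1 ≫ d.1) e.1 (D.compLoss c d) 0 =
      D.compLoss c (d ≫ e) + SGame.compLoss c.1 (d.1 ≫ e.1) 0 (D.compLoss d e)
  unitL {X Y : B.Obj} (c : X ⟶ Y) :
    D.cellLoss (BicategoryData.unitL c) + D.compLoss (𝟙 X) c +
      SGame.compLoss (𝟙 X.1) c.1 (D.idLoss X) 0 = 0
  unitR {X Y : B.Obj} (c : X ⟶ Y) :
    D.cellLoss (BicategoryData.unitR c) + D.compLoss c (𝟙 Y) +
      SGame.compLoss c.1 (𝟙 Y.1) 0 (D.idLoss Y) = 0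

/-- Losses are added pointwise. -/
instance : Add (LossData B) where
  add D E :=
    { loss := fun c => D.loss c + E.loss c
      cellLoss := fun α => D.cellLoss α + E.cellLoss α
      idLoss := fun X => D.idLoss X + E.idLoss X
      compLoss := fun c d => D.compLoss c d + E.compLoss c d
      cell_eq := fun α => by rw [D.cell_eq α, E.cell_eq α, add_add_add_comm]
      id_eq := fun X => by rw [add_add_add_comm, ← D.id_eq, ← E.id_eq, add_zero]
      comp_eq := fun c d => by
        rw [SGame.compLoss_add, D.comp_eq, E.comp_eq, add_add_add_comm] }

/-- All losses are zero. -/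
instance : Zero (LossData B) where
  zero :=
    { loss := fun _ => 0
      cellLoss := fun _ => 0
      idLoss := fun _ => 0
      compLoss := fun _ _ => 0
      cell_eq := fun _ => (add_zero _).symm
      id_eq := fun _ => (add_zero _).symm
      comp_eq := fun c d => by rw [SGame.compLoss_zero, add_zero] }

section

variable (D E : LossData B) {X Y Z : B.Obj}

@[simp] lemma add_loss (c : X ⟶ Y) : (D + E).loss c = D.loss c + E.loss c := rfl
@[simp] lemma add_cellLoss {c d : X ⟶ Y} (α : c ⟶ d) :
  (D + E).cellLoss α = D.cellLoss α + E.cellLoss α := rfl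
@[simp] lemma add_idLoss (X : B.Obj) : (D + E).idLoss X = D.idLoss X + E.idLoss X := rfl
@[simp] lemma add_compLoss (c : X ⟶ Y) (d : Y ⟶ Z) :
  (D + E).compLoss c d = D.compLoss c d + E.compLoss c d := rfl
@[simp] lemma zero_loss (c : X ⟶ Y) : (0 : LossData B).loss c = 0 := rfl
@[simp] lemma zero_cellLoss {c d : X ⟶ Y} (α : c ⟶ d) : (0 : LossData B).cellLoss α = 0 := rfl
@[simp] lemma zero_idLoss (X : B.Obj) : (0 : LossData B).idLoss X = 0 := rfl
@[simp] lemma zero_compLoss (c : X ⟶ Y) (d : Y ⟶ Z) : (0 : LossData B).compLoss c d = 0 := rfl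

end

instance : AddCommMonoid (LossData B) where
  nsmul := nsmulRec
  add_assoc D E F := by ext <;> simp [add_assoc]
  add_comm D E := by ext <;> simp [add_comm]
  zero_add D := by ext <;> simp
  add_zero D := by ext <;> simp

/-- The equations of `LossData.IsLax` are additive: each side is a sum of losses and of values of
the additive operation `SGame.compLoss`. -/
lemma IsLax.add {D E : LossData B} (hD : D.IsLax) (hE : E.IsLax) : (D + E).IsLax where
  id c := by simp [hD.id, hE.id]
  comp α β := by simp only [add_cellLoss, hD.comp, hE.comp]; exact add_add_add_comm _ _ _ _
  naturality α β := by
    simp only [add_cellLoss, add_compLoss, SGame.compLoss_add]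
    rw [add_add_add_comm, hD.naturality, hE.naturality, add_add_add_comm]
  assoc c d e := by
    simp only [add_cellLoss, add_compLoss]
    have h1 := SGame.compLoss_add (c.1 ≫ d.1) e.1 (D.compLoss c d) (E.compLoss c d) 0 0
    have h2 := SGame.compLoss_add c.1 (d.1 ≫ e.1) 0 0 (D.compLoss d e) (E.compLoss d e)
    rw [add_zero] at h1 h2
    rw [h1, h2, add_add_add_comm (D.compLoss c (d ≫ e)), ← hD.assoc, ← hE.assoc]
    abel
  unitL {X Y} c := by
    simp only [add_cellLoss, add_compLoss, add_idLoss]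
    have h := SGame.compLoss_add (𝟙 X.1) c.1 (D.idLoss X) (E.idLoss X) 0 0
    rw [add_zero] at h
    rw [h, add_add_add_comm (D.cellLoss _), add_add_add_comm, hD.unitL, hE.unitL, add_zero]
  unitR {X Y} c := by
    simp only [add_cellLoss, add_compLoss, add_idLoss]
    have h := SGame.compLoss_add c.1 (𝟙 Y.1) 0 0 (D.idLoss Y) (E.idLoss Y)
    rw [add_zero] at h
    rw [h, add_add_add_comm (D.cellLoss _), add_add_add_comm, hD.unitR, hE.unitR, add_zero]

lemma IsLax.zero : (0 : LossData B).IsLax where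
  id _ := rfl
  comp _ _ := (add_zero _).symm
  naturality _ _ := by simp [SGame.compLoss_zero]
  assoc _ _ _ := by simp [SGame.compLoss_zero]
  unitL _ := by simp [SGame.compLoss_zero]
  unitR _ := by simp [SGame.compLoss_zero]

end LossData

namespace LossModel

lemma isLax (L : LossModel B) : L.toLossData.IsLax where
  id c := congrArg (fun t => t.1.loss) (L.map₂_id c)
  comp α β := congrArg (fun t => t.1.loss) (L.map₂_comp α β)
  naturality α β := congrArg (fun t => t.1.loss) (L.mapComp_naturality α β)
  assoc c d e := (congrArg (fun t => t.1.loss) (L.map₂_assoc c d e)).trans (add_zero _)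
  unitL c := congrArg (fun t => t.1.loss) (L.map₂_unitL c)
  unitR c := congrArg (fun t => t.1.loss) (L.map₂_unitR c)

/-- The loss model with given losses. The equations on underlying 2-cells of lenses are those of the
identity lax functor. -/
def ofIsLax (D : LossData B) (h : D.IsLax) : LossModel B where
  toLossData := D
  map₂_id c := SGame.above_hom₂_ext rfl (h.id c)
  map₂_comp α β := SGame.above_hom₂_ext rfl (h.comp α β)
  mapComp_naturality α β := SGame.above_hom₂_ext
    ((Category.id_comp _).trans (Category.comp_id _).symm) (h.naturality α β)
  map₂_assoc c d e := SGame.above_hom₂_ext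
    (congrArg (fun t => t.val) ((LaxFun.id B.Obj).map₂_assoc c d e))
    ((h.assoc c d e).trans (add_zero _).symm)
  map₂_unitL c := SGame.above_hom₂_ext
    (congrArg (fun t => t.val) ((LaxFun.id B.Obj).map₂_unitL c)) (h.unitL c)
  map₂_unitR c := SGame.above_hom₂_ext
    (congrArg (fun t => t.val) ((LaxFun.id B.Obj).map₂_unitR c)) (h.unitR c)

lemma toLossData_injective :
    Function.Injective (toLossData : LossModel B → LossData B) := by
  rintro ⟨D, _, _, _, _, _, _⟩ ⟨E, _, _, _, _, _, _⟩ h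
  cases h
  rfl

instance : Add (LossModel B) where
  add L M := ofIsLax (L.toLossData + M.toLossData) (L.isLax.add M.isLax)

instance : Zero (LossModel B) where
  zero := ofIsLax 0 LossData.IsLax.zero

@[simp] lemma add_toLossData (L M : LossModel B) :
  (L + M).toLossData = L.toLossData + M.toLossData := rfl
@[simp] lemma zero_toLossData : (0 : LossModel B).toLossData = 0 := rfl

instance : AddCommMonoid (LossModel B) where
  nsmul := nsmulRec
  add_assoc L M N := toLossData_injective (add_assoc L.toLossData M.toLossData N.toLossData)
  add_comm L M := toLossData_injective (add_comm L.toLossData M.toLossData)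
  zero_add L := toLossData_injective (zero_add L.toLossData)
  add_zero L := toLossData_injective (add_zero L.toLossData)

/-! ### The category of loss models and icons -/

namespace Icon

variable {L M N : LossModel B}

lemma ext_cell_loss {η θ : Icon L M}
    (hc : ∀ {X Y : B.Obj} (c : X ⟶ Y), η.cell c = θ.cell c)
    (hl : ∀ {X Y : B.Obj} (c : X ⟶ Y), η.loss c = θ.loss c) : η = θ := by
  apply Icon.ext
  funext X Y c
  exact SGame.above_hom₂_ext (congrArg (fun t => t.val) (hc c)) (hl c)

section

variable (η : Icon L M) {X Y Z : B.Obj}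

lemma loss_eq (c : X ⟶ Y) : L.loss c = M.loss c + η.loss c := (η.app c).1.loss_eq

lemma cell_naturality {c d : X ⟶ Y} (α : c ⟶ d) : η.cell c ≫ α = α ≫ η.cell d :=
  SubBicategory.Cell.ext (congrArg (fun t => t.1.cell) (η.naturality α))

lemma loss_naturality {c d : X ⟶ Y} (α : c ⟶ d) :
    M.cellLoss α + η.loss c = η.loss d + L.cellLoss α :=
  congrArg (fun t => t.1.loss) (η.naturality α)

lemma cell_unity (X : B.Obj) : η.cell (𝟙 X) = 𝟙 (𝟙 X) :=
  SubBicategory.Cell.ext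
    ((Category.id_comp _).symm.trans (congrArg (fun t => t.1.cell) (η.unity X)))

lemma loss_unity (X : B.Obj) : η.loss (𝟙 X) + L.idLoss X = M.idLoss X :=
  congrArg (fun t => t.1.loss) (η.unity X)

lemma cell_composition (c : X ⟶ Y) (d : Y ⟶ Z) :
    η.cell (c ≫ d) = hcomp (η.cell c) (η.cell d) :=
  SubBicategory.Cell.ext ((Category.id_comp _).symm.trans
    ((congrArg (fun t => t.1.cell) (η.composition c d)).trans (Category.comp_id _)))

lemma loss_composition (c : X ⟶ Y) (d : Y ⟶ Z) :
    η.loss (c ≫ d) + L.compLoss c d =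
      M.compLoss c d + SGame.compLoss c.1 d.1 (η.loss c) (η.loss d) :=
  congrArg (fun t => t.1.loss) (η.composition c d)

end

/-- The icon with given underlying 2-cells and losses. -/
def ofCellLoss (cell : ∀ {X Y : B.Obj} (c : X ⟶ Y), c ⟶ c)
    (loss : ∀ {X Y : B.Obj} (_ : X ⟶ Y), Loss X.1.fst Y.1.snd)
    (loss_eq : ∀ {X Y : B.Obj} (c : X ⟶ Y), L.loss c = M.loss c + loss c)
    (cell_naturality : ∀ {X Y : B.Obj} {c d : X ⟶ Y} (α : c ⟶ d), cell c ≫ α = α ≫ cell d)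
    (loss_naturality : ∀ {X Y : B.Obj} {c d : X ⟶ Y} (α : c ⟶ d),
      M.cellLoss α + loss c = loss d + L.cellLoss α)
    (cell_unity : ∀ X : B.Obj, cell (𝟙 X) = 𝟙 (𝟙 X))
    (loss_unity : ∀ X : B.Obj, loss (𝟙 X) + L.idLoss X = M.idLoss X)
    (cell_composition : ∀ {X Y Z : B.Obj} (c : X ⟶ Y) (d : Y ⟶ Z),
      cell (c ≫ d) = hcomp (cell c) (cell d))
    (loss_composition : ∀ {X Y Z : B.Obj} (c : X ⟶ Y) (d : Y ⟶ Z),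
      loss (c ≫ d) + L.compLoss c d =
        M.compLoss c d + SGame.compLoss c.1 d.1 (loss c) (loss d)) : Icon L M where
  app c := ⟨⟨(cell c).val, loss c, loss_eq c⟩, (cell c).mem⟩
  naturality α := SGame.above_hom₂_ext (congrArg (fun t => t.val) (cell_naturality α))
    (loss_naturality α)
  unity X := SGame.above_hom₂_ext
    ((Category.id_comp _).trans (congrArg (fun t => t.val) (cell_unity X))) (loss_unity X)
  composition c d := SGame.above_hom₂_ext
    ((Category.id_comp _).trans
      ((congrArg (fun t => t.val) (cell_composition c d)).trans (Category.comp_id _).symm))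
    (loss_composition c d)

/-- The identity icon. -/
def id (L : LossModel B) : Icon L L where
  app c := 𝟙 (L.map c)
  naturality α := (Category.id_comp _).trans (Category.comp_id _).symm
  unity X := Category.comp_id _
  composition c d := by rw [hcomp_id, Category.comp_id, Category.id_comp]

/-- The componentwise composite of icons. -/
def comp (η : Icon L M) (θ : Icon M N) : Icon L N where
  app c := η.app c ≫ θ.app c
  naturality α := by
    rw [Category.assoc, θ.naturality, ← Category.assoc, η.naturality, Category.assoc]
  unity X := by rw [← Category.assoc, η.unity, θ.unity]
  composition c d := by
    rw [← Category.assoc, η.composition, Category.assoc, θ.composition, hcomp_comp,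
      Category.assoc]

end Icon

instance : Category.{max u v} (LossModel B) where
  Hom := Icon
  id := Icon.id
  comp := Icon.comp
  id_comp _ := Icon.ext (funext fun _ => funext fun _ => funext fun _ => Category.id_comp _)
  comp_id _ := Icon.ext (funext fun _ => funext fun _ => funext fun _ => Category.comp_id _)
  assoc _ _ _ := Icon.ext (funext fun _ => funext fun _ => funext fun _ => Category.assoc _ _ _)

namespace Icon

section

variable {L M N : LossModel B} {X Y : B.Obj}

lemma hom_ext {η θ : L ⟶ M} (hc : ∀ {X Y : B.Obj} (c : X ⟶ Y), cell η c = cell θ c)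
    (hl : ∀ {X Y : B.Obj} (c : X ⟶ Y), loss η c = loss θ c) : η = θ :=
  ext_cell_loss hc hl

@[simp] lemma cell_id (c : X ⟶ Y) : cell (𝟙 L) c = 𝟙 c := rfl
@[simp] lemma loss_id (c : X ⟶ Y) : loss (𝟙 L) c = 0 := rfl
@[simp] lemma cell_comp (η : L ⟶ M) (θ : M ⟶ N) (c : X ⟶ Y) :
  cell (η ≫ θ) c = cell η c ≫ cell θ c := rfl
@[simp] lemma loss_comp (η : L ⟶ M) (θ : M ⟶ N) (c : X ⟶ Y) :
  loss (η ≫ θ) c = loss θ c + loss η c := rfl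

@[simp] lemma cell_eqToHom (h : L = M) (c : X ⟶ Y) : cell (eqToHom h) c = 𝟙 c := by
  subst h; rfl

@[simp] lemma loss_eqToHom (h : L = M) (c : X ⟶ Y) : loss (eqToHom h) c = 0 := by
  subst h; rfl

/-- Underlying 2-cells of any two icons commute: those of the second are 2-cells of `B`, so the
first is natural with respect to them. This gives the interchange law for the sum of icons and the
naturality of the symmetry. -/
lemma cell_comm {L' M' : LossModel B} (η : Icon L L') (θ : Icon M M') (c : X ⟶ Y) :
    η.cell c ≫ θ.cell c = θ.cell c ≫ η.cell c :=
  η.cell_naturality (θ.cell c)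

end

/-! ### The symmetric monoidal structure -/

/-- The sum of icons: underlying 2-cells are composed and losses are added. -/
def sum {L L' M M' : LossModel B} (η : Icon L L') (θ : Icon M M') : Icon (L + M) (L' + M') :=
  ofCellLoss (fun c => η.cell c ≫ θ.cell c) (fun c => η.loss c + θ.loss c)
    (fun c => by
      simp only [add_toLossData, LossData.add_loss]
      rw [η.loss_eq, θ.loss_eq, add_add_add_comm])
    (fun α => by
      rw [Category.assoc, θ.cell_naturality, ← Category.assoc, η.cell_naturality, Category.assoc])
    (fun α => by
      simp only [add_toLossData, LossData.add_cellLoss]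
      rw [add_add_add_comm, η.loss_naturality, θ.loss_naturality, add_add_add_comm])
    (fun X => by rw [η.cell_unity, θ.cell_unity, Category.id_comp])
    (fun X => by
      simp only [add_toLossData, LossData.add_idLoss]
      rw [add_add_add_comm, η.loss_unity, θ.loss_unity])
    (fun c d => by rw [η.cell_composition, θ.cell_composition, hcomp_comp])
    (fun c d => by
      simp only [add_toLossData, LossData.add_compLoss]
      rw [add_add_add_comm, η.loss_composition, θ.loss_composition, SGame.compLoss_add,
        add_add_add_comm])

end Icon

instance : MonoidalCategoryStruct (LossModel B) where
  tensorObj L M := L + M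
  tensorHom η θ := Icon.sum η θ
  whiskerLeft L _ _ θ := Icon.sum (𝟙 L) θ
  whiskerRight η M := Icon.sum η (𝟙 M)
  tensorUnit := 0
  associator L M N := eqToIso (add_assoc L M N)
  leftUnitor L := eqToIso (zero_add L)
  rightUnitor L := eqToIso (add_zero L)

namespace Icon

variable {L L' M M' N : LossModel B} {X Y : B.Obj} (c : X ⟶ Y)

@[simp] lemma cell_tensorHom (η : L ⟶ L') (θ : M ⟶ M') :
  cell (η ⊗ₘ θ) c = cell η c ≫ cell θ c := rfl
@[simp] lemma loss_tensorHom (η : L ⟶ L') (θ : M ⟶ M') :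
  loss (η ⊗ₘ θ) c = loss η c + loss θ c := rfl
@[simp] lemma cell_associator : cell (α_ L M N).hom c = 𝟙 c :=
  cell_eqToHom (add_assoc L M N) c
@[simp] lemma cell_associator_inv : cell (α_ L M N).inv c = 𝟙 c :=
  cell_eqToHom (add_assoc L M N).symm c
@[simp] lemma loss_associator : loss (α_ L M N).hom c = 0 :=
  loss_eqToHom (add_assoc L M N) c
@[simp] lemma loss_associator_inv : loss (α_ L M N).inv c = 0 :=
  loss_eqToHom (add_assoc L M N).symm c
@[simp] lemma cell_leftUnitor : cell (λ_ L).hom c = 𝟙 c :=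
  cell_eqToHom (zero_add L) c
@[simp] lemma loss_leftUnitor : loss (λ_ L).hom c = 0 :=
  loss_eqToHom (zero_add L) c
@[simp] lemma cell_rightUnitor : cell (ρ_ L).hom c = 𝟙 c :=
  cell_eqToHom (add_zero L) c
@[simp] lemma loss_rightUnitor : loss (ρ_ L).hom c = 0 :=
  loss_eqToHom (add_zero L) c

end Icon

instance : MonoidalCategory (LossModel B) :=
  MonoidalCategory.ofTensorHom
    (id_tensorHom_id := fun L M => Icon.hom_ext (by simp) (by simp))
    (id_tensorHom := fun _ _ _ _ => rfl)
    (tensorHom_id := fun _ _ => rfl)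
    (tensorHom_comp_tensorHom := fun η η' θ θ' => Icon.hom_ext
      (fun c => by
        simp only [Icon.cell_comp, Icon.cell_tensorHom, Category.assoc]
        rw [← Category.assoc (Icon.cell η' c), Icon.cell_comm η' θ c, Category.assoc])
      (fun c => by
        simp only [Icon.loss_comp, Icon.loss_tensorHom]
        exact add_add_add_comm _ _ _ _))
    (associator_naturality := fun _ _ _ => Icon.hom_ext (by simp) (by simp [add_assoc]))
    (leftUnitor_naturality := fun _ => Icon.hom_ext (by simp) (by simp))
    (rightUnitor_naturality := fun _ => Icon.hom_ext (by simp) (by simp))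
    (pentagon := fun _ _ _ _ => Icon.hom_ext (by simp) (by simp))
    (triangle := fun _ _ => Icon.hom_ext (by simp) (by simp))

/-- The symmetry is the identity, as sums of losses commute. -/
instance : BraidedCategory (LossModel B) where
  braiding L M := eqToIso (add_comm L M)
  braiding_naturality_right L M N θ := Icon.hom_ext (by simp [← id_tensorHom, ← tensorHom_id])
    (by simp [← id_tensorHom, ← tensorHom_id])
  braiding_naturality_left η N := Icon.hom_ext (by simp [← id_tensorHom, ← tensorHom_id])
    (by simp [← id_tensorHom, ← tensorHom_id])
  hexagon_forward L M N := Icon.hom_ext (by simp [← id_tensorHom, ← tensorHom_id])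
    (by simp [← id_tensorHom, ← tensorHom_id])
  hexagon_reverse L M N := Icon.hom_ext (by simp [← id_tensorHom, ← tensorHom_id])
    (by simp [← id_tensorHom, ← tensorHom_id])

@[simp] lemma Icon.cell_braiding (L M : LossModel B) {X Y : B.Obj} (c : X ⟶ Y) :
    cell (β_ L M).hom c = 𝟙 c :=
  cell_eqToHom (add_comm L M) c

@[simp] lemma Icon.loss_braiding (L M : LossModel B) {X Y : B.Obj} (c : X ⟶ Y) :
    loss (β_ L M).hom c = 0 :=
  loss_eqToHom (add_comm L M) c

instance : SymmetricCategory (LossModel B) where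
  symmetry L M := Icon.hom_ext (by simp) (by simp)

end LossModel

end StatGame

theorem mainTheorem6 {C : Type u} [Category.{v} C] [MonoidalCategory C] [CopyDiscardCategory C]
    [BilinearEffects C] (B : SubBicategory (BayesLens C)) :
    ∃ (_ : Category.{max u v} (LossModel B)) (icon : ∀ {L M : LossModel B}, (L ⟶ M) ≃ LossModel.Icon L M)
      (_ : MonoidalCategory (LossModel B)) (_ : SymmetricCategory (LossModel B)),
      -- identities and composition are those of icons
      (∀ (L : LossModel B) {X Y : B.Obj} (c : X ⟶ Y), (icon (𝟙 L)).app c = 𝟙 (L.map c)) ∧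
      (∀ {L M N : LossModel B} (η : L ⟶ M) (θ : M ⟶ N) {X Y : B.Obj} (c : X ⟶ Y),
        (icon (η ≫ θ)).app c = (icon η).app c ≫ (icon θ).app c) ∧
      -- the tensor product is the pointwise sum of the losses
      (∀ (L M : LossModel B) {X Y : B.Obj} (c : X ⟶ Y), (L ⊗ M).loss c = L.loss c + M.loss c) ∧
      (∀ (L M : LossModel B) {X Y : B.Obj} {c d : X ⟶ Y} (α : c ⟶ d),
        (L ⊗ M).cellLoss α = L.cellLoss α + M.cellLoss α) ∧
      (∀ (L M : LossModel B) (X : B.Obj), (L ⊗ M).idLoss X = L.idLoss X + M.idLoss X) ∧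
      (∀ (L M : LossModel B) {X Y Z : B.Obj} (c : X ⟶ Y) (d : Y ⟶ Z),
        (L ⊗ M).compLoss c d = L.compLoss c d + M.compLoss c d) ∧
      (∀ {L L' M M' : LossModel B} (η : L ⟶ L') (θ : M ⟶ M') {X Y : B.Obj} (c : X ⟶ Y),
        (icon (η ⊗ₘ θ)).cell c = (icon η).cell c ≫ (icon θ).cell c ∧
        (icon (η ⊗ₘ θ)).loss c = (icon η).loss c + (icon θ).loss c) ∧
      -- the unit is zero
      (∀ {X Y : B.Obj} (c : X ⟶ Y), (𝟙_ (LossModel B)).loss c = 0) ∧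
      (∀ {X Y : B.Obj} {c d : X ⟶ Y} (α : c ⟶ d), (𝟙_ (LossModel B)).cellLoss α = 0) ∧
      (∀ X : B.Obj, (𝟙_ (LossModel B)).idLoss X = 0) ∧
      (∀ {X Y Z : B.Obj} (c : X ⟶ Y) (d : Y ⟶ Z), (𝟙_ (LossModel B)).compLoss c d = 0) ∧
      -- the structure isomorphisms have identities as 2-cells and zero losses
      (∀ (L M N : LossModel B) {X Y : B.Obj} (c : X ⟶ Y),
        (icon (α_ L M N).hom).cell c = 𝟙 c ∧ (icon (α_ L M N).hom).loss c = 0) ∧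
      (∀ (L : LossModel B) {X Y : B.Obj} (c : X ⟶ Y),
        (icon (λ_ L).hom).cell c = 𝟙 c ∧ (icon (λ_ L).hom).loss c = 0) ∧
      (∀ (L : LossModel B) {X Y : B.Obj} (c : X ⟶ Y),
        (icon (ρ_ L).hom).cell c = 𝟙 c ∧ (icon (ρ_ L).hom).loss c = 0) ∧
      (∀ (L M : LossModel B) {X Y : B.Obj} (c : X ⟶ Y),
        (icon (β_ L M).hom).cell c = 𝟙 c ∧ (icon (β_ L M).hom).loss c = 0) := by
  refine ⟨inferInstance, Equiv.refl _, inferInstance, inferInstance, fun _ _ _ _ => rfl,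
    fun _ _ _ _ _ => rfl, fun _ _ _ _ _ => rfl, fun _ _ _ _ _ _ _ => rfl, fun _ _ _ => rfl,
    fun _ _ _ _ _ _ _ => rfl, fun _ _ _ _ _ => ⟨rfl, rfl⟩, fun _ => rfl, fun _ => rfl,
    fun _ => rfl, fun _ _ => rfl, ?_, ?_, ?_, ?_⟩
  · exact fun L M N _ _ c =>
      ⟨LossModel.Icon.cell_associator c, LossModel.Icon.loss_associator c⟩
  · exact fun L _ _ c => ⟨LossModel.Icon.cell_leftUnitor c, LossModel.Icon.loss_leftUnitor c⟩
  · exact fun L _ _ c => ⟨LossModel.Icon.cell_rightUnitor c, LossModel.Icon.loss_rightUnitor c⟩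
  · exact fun L M _ _ c => ⟨LossModel.Icon.cell_braiding L M c, LossModel.Icon.loss_braiding L M c⟩
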